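/- Let $G$ be a finite connected metric graph with at least one edge: it has finitely many vertices (set $\mathcal V$) and finitely many edges $I_j$, each parametrized by arc length by $[0,s_j]$, $s_j>0$, the parameters $0$ and $s_j$ being vertices; $G$ carries the path distance $d$. Let $L$ be a Lagrangian on $G$, that is, a family of functions $L_j:[0,s_j]\times\mathbb R\to\mathbb R$ of class $C^2$ (up to the ends) such that $L_j(x,\cdot)$ is strictly convex and superlinear for every $x$, and such that at every vertex $e$ the numbers $L_j(e,0)$ are the same for all edges $I_j$ at $e$. For an absolutely continuous curve $\gamma:[0,t]\to G$ let $A(\gamma)=\int_0^t L(\gamma,\dot\gamma)\,ds\in\mathbb R\cup\{+\infty\}$, where $\dot\gamma$ is the derivative of the arc length coordinate while $\gamma$ is inside an edge and $\dot\gamma=0$ while $\gamma$ is at a vertex. For $t\ge 0$ let $h_t(y,x)$ be the infimum of $A(\gamma)$ over the absolutely continuous $\gamma:[0,t]\to G$ with $\gamma(0)=y$, $\gamma(t)=x$ ($+\infty$ if there are none), and $$\mathcal L_tf(x)=\inf_{y\in G}\bigl(f(y)+h_t(y,x)\bigr)$$ (so $\mathcal L_0f=f$). Define the Hamiltonian by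 $$H_j(x,p)=\max\{-pz-L_j(x,-z)\},$$ the maximum being over all $z\in\mathbb R$ if $x$ is inside $I_j$, and over the $z$ that are zero or point into $I_j$ if $x$ is an end of $I_j$ ($z\ge0$ at parameter $0$, $z\le 0$ at parameter $s_j$). Let $f:G\to\mathbb R$ be continuous. Then $\mathcal L_tf(x)$ is finite for all $x\in G$, $t\ge0$, and $u(x,t)=\mathcal L_tf(x)$ is a viscosity solution on $G\times[0,\infty)$ of $$u_t(x,t)+H(x,D_xu(x,t))=0 .$$ This means the following. The function $u$ is continuous on $G\times[0,\infty)$. Let $x\in G$, $t>0$, and let $\varphi$ be a function that is $C^1$ near $(x,t)$, i.e. whose restriction to $I_j\times(t-\delta,t+\delta)$ is $C^1$ near $(x,t)$, up to the vertices, for each edge $I_j\ni x$. If $u-\varphi$ has a local maximum at $(x,t)$, then $$\varphi_t(x,t)+\max\{H_j(x,D^j\varphi(x,t)): x\in I_j\}\le 0,$$ and if $u-\varphi$ has a local minimum at $(x,t)$, then $$\varphi_t(x,t)+\max\{H_j(x,D^j\varphi(x,t)): x\in I_j\}\ge 0.$$ Here $D^j\varphi$ is the derivative in the arc length coordinate of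 $I_j$, one-sided at the ends. If $x\notin\mathcal V$ there is only one $I_j\ni x$; if $I_j$ is a loop at $x$, both of its ends count. -/

import Mathlib

open Set Filter Topology MeasureTheory

noncomputable section

/-- A connected metric graph with vertex set `V` and edge set `E`. The edge `j` is parametrized by
arc length by `[0, len j]`; the parameter `0` is the vertex `src j`, the parameter `len j` is the
vertex `tgt j`. Multiple edges, loops and vertices of degree one are allowed. -/
structure MetricGraph (V E : Type*) where
  src : E → V
  tgt : E → V
  len : E → ℝ
  len_pos : ∀ j, 0 < len j
  connected : ∀ v w : V, Relation.EqvGen (fun a b => ∃ j, src j = a ∧ tgt j = b) v w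

namespace MetricGraph

variable {V E : Type*} (G : MetricGraph V E)

/-- The points of the graph: the vertices and the points of the open edges. -/
inductive Pt : Type _ where
  | vertex (v : V) : Pt
  | inner (j : E) (x : ℝ) (hx : x ∈ Ioo 0 (G.len j)) : Pt

/-- The parametrization `[0, len j] → G` of the edge `j` (constant outside of `[0, len j]`). -/
def pt (j : E) (x : ℝ) : G.Pt :=
  if h₀ : x ≤ 0 then Pt.vertex (G.src j)
  else if h₁ : G.len j ≤ x then Pt.vertex (G.tgt j)
  else Pt.inner j x ⟨not_le.mp h₀, not_le.mp h₁⟩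

/-- `G.PathLength x y ℓ`: there is a path from `x` to `y` of length `ℓ` that is made of finitely many
pieces, each of which runs along a segment of one edge at unit speed. -/
inductive PathLength : G.Pt → G.Pt → ℝ → Prop
  | refl (x : G.Pt) : PathLength x x 0
  | step {x : G.Pt} {j : E} {a b ℓ : ℝ} (ha : a ∈ Icc 0 (G.len j)) (hb : b ∈ Icc 0 (G.len j))
      (h : PathLength x (G.pt j a) ℓ) : PathLength x (G.pt j b) (ℓ + |b - a|)

variable {G}

theorem PathLength.nonneg {x y : G.Pt} {ℓ : ℝ} (h : G.PathLength x y ℓ) : 0 ≤ ℓ := by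
  induction h with
  | refl => exact le_rfl
  | step _ _ _ ih => positivity

theorem PathLength.append {x y z : G.Pt} {ℓ m : ℝ} (h : G.PathLength x y ℓ)
    (h' : G.PathLength y z m) : G.PathLength x z (ℓ + m) := by
  induction h' with
  | refl => simpa using h
  | step ha hb _ ih =>
    rw [← add_assoc]
    exact PathLength.step ha hb ih

theorem PathLength.segment {j : E} {a b : ℝ} (ha : a ∈ Icc 0 (G.len j))
    (hb : b ∈ Icc 0 (G.len j)) : G.PathLength (G.pt j a) (G.pt j b) |b - a| := by
  simpa using PathLength.step ha hb (PathLength.refl (G.pt j a))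

theorem PathLength.symm {x y : G.Pt} {ℓ : ℝ} (h : G.PathLength x y ℓ) : G.PathLength y x ℓ := by
  induction h with
  | refl => exact PathLength.refl _
  | step ha hb _ ih =>
    rw [add_comm, abs_sub_comm]
    exact (PathLength.segment hb ha).append ih

variable (G)

theorem pt_zero (j : E) : G.pt j 0 = Pt.vertex (G.src j) := by simp [pt]

theorem pt_len (j : E) : G.pt j (G.len j) = Pt.vertex (G.tgt j) := by
  simp [pt, not_le.mpr (G.len_pos j)]

theorem pt_inner (j : E) (x : ℝ) (hx : x ∈ Ioo 0 (G.len j)) : G.pt j x = Pt.inner j x hx := by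
  simp [pt, not_le.mpr hx.1, not_le.mpr hx.2]

theorem exists_pathLength (x y : G.Pt) : ∃ ℓ, G.PathLength x y ℓ := by
  have key : ∀ v w : V, ∃ ℓ, G.PathLength (Pt.vertex v) (Pt.vertex w) ℓ := by
    intro v w
    induction G.connected v w with
    | rel a b h =>
      obtain ⟨j, rfl, rfl⟩ := h
      rw [← pt_zero, ← pt_len]
      exact ⟨_, PathLength.segment ⟨le_rfl, (G.len_pos j).le⟩ ⟨(G.len_pos j).le, le_rfl⟩⟩
    | refl a => exact ⟨0, PathLength.refl _⟩
    | symm a b _ ih => exact ⟨_, ih.choose_spec.symm⟩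
    | trans a b c _ _ ih₁ ih₂ => exact ⟨_, ih₁.choose_spec.append ih₂.choose_spec⟩
  have toVertex : ∀ z : G.Pt, ∃ v ℓ, G.PathLength z (Pt.vertex v) ℓ := by
    rintro (v | ⟨j, s, hs⟩)
    · exact ⟨v, 0, PathLength.refl _⟩
    · refine ⟨G.src j, |0 - s|, ?_⟩
      rw [← pt_zero, ← pt_inner]
      exact PathLength.segment ⟨hs.1.le, hs.2.le⟩ ⟨le_rfl, (G.len_pos j).le⟩
  obtain ⟨v, a, ha⟩ := toVertex x
  obtain ⟨w, b, hb⟩ := toVertex y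
  obtain ⟨c, hc⟩ := key v w
  exact ⟨_, (ha.append hc).append hb.symm⟩

/-- The distance of `G`: the infimum of the lengths of the paths from `x` to `y`. -/
instance : PseudoMetricSpace G.Pt where
  dist x y := sInf {ℓ | G.PathLength x y ℓ}
  dist_self x := le_antisymm (csInf_le ⟨0, fun _ h => PathLength.nonneg h⟩ (PathLength.refl x))
    (Real.sInf_nonneg fun _ h => PathLength.nonneg h)
  dist_comm x y := by
    congr 1
    ext ℓ
    exact ⟨PathLength.symm, PathLength.symm⟩
  dist_triangle x y z := by
    have hb : ∀ a b : G.Pt, BddBelow {ℓ | G.PathLength a b ℓ} :=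
      fun _ _ => ⟨0, fun _ h => PathLength.nonneg h⟩
    refine le_of_forall_pos_le_add fun ε hε => ?_
    obtain ⟨ℓ, h, hlt⟩ := exists_lt_of_csInf_lt (G.exists_pathLength x y)
      (lt_add_of_pos_right (sInf {ℓ | G.PathLength x y ℓ}) (half_pos hε))
    obtain ⟨m, h', hlt'⟩ := exists_lt_of_csInf_lt (G.exists_pathLength y z)
      (lt_add_of_pos_right (sInf {ℓ | G.PathLength y z ℓ}) (half_pos hε))
    have := csInf_le (hb x z) (PathLength.append h h')
    linarith

variable {G}

/-- The arc length coordinate of a point of an open edge (with the value `0` at the vertices). -/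
def Pt.coord : G.Pt → ℝ
  | .vertex _ => 0
  | .inner _ x _ => x

variable (G)

/-- A Lagrangian on `G`: functions `L j x v` for `x ∈ [0, len j]` and `v ∈ ℝ`, of class `C²` up to
the vertices, strictly convex and superlinear in `v`. At a vertex `w`, the numbers `L j w 0` for the
edges `j` at `w` have one common value, `rest w`. -/
structure Lagrangian where
  toFun : E → ℝ → ℝ → ℝ
  rest : V → ℝ
  contDiffOn : ∀ j, ContDiffOn ℝ 2 (fun q : ℝ × ℝ => toFun j q.1 q.2)
    (Icc 0 (G.len j) ×ˢ univ)
  strictConvexOn : ∀ j, ∀ x ∈ Icc 0 (G.len j), StrictConvexOn ℝ univ (toFun j x)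
  superlinear : ∀ j, ∀ x ∈ Icc 0 (G.len j),
    Tendsto (fun v => toFun j x v / |v|) (cocompact ℝ) atTop
  rest_src : ∀ j, toFun j 0 0 = rest (G.src j)
  rest_tgt : ∀ j, toFun j (G.len j) 0 = rest (G.tgt j)

namespace Lagrangian

variable {G} (L : G.Lagrangian)

/-- `L (γ t, γ' t)`. When `γ t` is in an open edge, `γ' t` is the derivative of the arc length
coordinate along `γ`; when `γ t` is a vertex, `γ' t = 0`. -/
def along (γ : ℝ → G.Pt) (t : ℝ) : ℝ :=
  match γ t with
  | .vertex v => L.rest v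
  | .inner j x _ => L.toFun j x (deriv (fun s => (γ s).coord) t)

open Classical in
/-- The action on `[a, b]` of an absolutely continuous curve. As `L` is bounded from below, it is
`+∞` when the integrand is not integrable. -/
def action (γ : ℝ → G.Pt) (a b : ℝ) : EReal :=
  if IntervalIntegrable (L.along γ) volume a b then ((∫ t in a..b, L.along γ t : ℝ) : EReal) else ⊤

/-- `h t x y` is the least action of the absolutely continuous curves `γ : [0, t] → G` from `x`
to `y`. -/
def h (t : ℝ) (x y : G.Pt) : EReal :=
  ⨅ γ ∈ {γ : ℝ → G.Pt | AbsolutelyContinuousOnInterval γ 0 t ∧ γ 0 = x ∧ γ t = y}, L.action γ 0 t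

/-- The backward Lax-Oleinik semigroup. -/
def laxOleinik (t : ℝ) (f : G.Pt → ℝ) (x : G.Pt) : EReal :=
  ⨅ y : G.Pt, (f y : EReal) + L.h t y x

/-- The Hamiltonian of the edge `j` at the parameter `x ∈ [0, len j]`: the maximum of
`- p z - L j x (-z)` over all `z ∈ ℝ` if `x` is inside the edge, and over the `z` that are zero or
point into the edge if `x` is an end of the edge. -/
def hamiltonian (j : E) (x p : ℝ) : ℝ :=
  sSup {r | ∃ z : ℝ, (x = 0 → 0 ≤ z) ∧ (x = G.len j → z ≤ 0) ∧ r = -p * z - L.toFun j x (-z)}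

end Lagrangian

variable {G}

/-- `φ` is of class `C¹` near `(P, t)`: on each edge through `P`, it is a `C¹` function of the arc
length coordinate and time, up to the vertices, near the point `P` and the time `t`. -/
def C1Near (φ : G.Pt → ℝ → ℝ) (P : G.Pt) (t : ℝ) : Prop :=
  ∀ j, ∀ x ∈ Icc 0 (G.len j), G.pt j x = P →
    ContDiffWithinAt ℝ 1 (fun q : ℝ × ℝ => φ (G.pt j q.1) q.2) (Icc 0 (G.len j) ×ˢ univ) (x, t)

/-- The derivative of `φ (·, t)` along the edge `j` in the arc length coordinate, one-sided at the
ends of the edge. -/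
def edgeDeriv (φ : G.Pt → ℝ → ℝ) (j : E) (x t : ℝ) : ℝ :=
  derivWithin (fun y => φ (G.pt j y) t) (Icc 0 (G.len j)) x

namespace Lagrangian

variable (L : G.Lagrangian)

/-- `H (P, D φ (P, t))`: when `P` is the point `x` of an open edge `j`, this is `H j x (φ_x)`; when
`P` is a vertex, it is the maximum of `H j P (D^j φ)` over the (ends of) edges `j` at `P`. -/
def hamiltonianAt (φ : G.Pt → ℝ → ℝ) (P : G.Pt) (t : ℝ) : ℝ :=
  sSup {r | ∃ j, ∃ x ∈ Icc 0 (G.len j), G.pt j x = P ∧ r = L.hamiltonian j x (edgeDeriv φ j x t)}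

/-- Viscosity subsolutions of `u_t + H(x, D_x u) = 0` for `t > 0`. -/
def IsViscositySubsolution (u : G.Pt → ℝ → ℝ) : Prop :=
  ∀ (P : G.Pt) (t : ℝ), 0 < t → ∀ φ : G.Pt → ℝ → ℝ, C1Near φ P t →
    IsLocalMax (fun q : G.Pt × ℝ => u q.1 q.2 - φ q.1 q.2) (P, t) →
    deriv (φ P) t + L.hamiltonianAt φ P t ≤ 0

/-- Viscosity supersolutions of `u_t + H(x, D_x u) = 0` for `t > 0`. -/
def IsViscositySupersolution (u : G.Pt → ℝ → ℝ) : Prop :=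
  ∀ (P : G.Pt) (t : ℝ), 0 < t → ∀ φ : G.Pt → ℝ → ℝ, C1Near φ P t →
    IsLocalMin (fun q : G.Pt × ℝ => u q.1 q.2 - φ q.1 q.2) (P, t) →
    0 ≤ deriv (φ P) t + L.hamiltonianAt φ P t

/-- Viscosity solutions of `u_t + H(x, D_x u) = 0` on `G × [0, ∞)`. Values of `u` at negative times
are irrelevant. -/
structure IsViscositySolution (u : G.Pt → ℝ → ℝ) : Prop where
  continuousOn : ContinuousOn (fun q : G.Pt × ℝ => u q.1 q.2) (univ ×ˢ Ici 0)
  sub : L.IsViscositySubsolution u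
  super : L.IsViscositySupersolution u

end Lagrangian

end MetricGraph

end

/-!
The value function `Lagrangian.value` is the infimum of `f (γ 0) + A(γ)` over the absolutely
continuous curves `γ` of finite action that end at `x` at time `t`. All arguments use nearly optimal
curves, so the existence of minimizers is never needed.

The lower bounds for actions come from calibrations (`sub_le_integral_along`): if `g` is Lipschitz,
then `g ∘ γ` is absolutely continuous, and if its derivative is at most `L + c` almost everywhere,
then `g (γ b) - g (γ a) ≤ A(γ) + c * (b - a)`. The times at which `γ` is at a vertex, which may be
a set of positive measure, contribute nothing to the left-hand side, as the derivative of any real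
function vanishes almost everywhere on its level sets (`ae_deriv_eq_zero_of_eq_const`). With
multiples of the distance for `g` and the uniform superlinearity of `L`
(`exists_forall_mul_abs_sub_le`), this bounds the displacement of a curve by its action
(`mul_dist_le_integral_along`).

Continuity rests on an estimate in time, `exists_pos_value_le_value_add`: `f` is at most the value
function at a short time plus `ε`, because a curve pays more for a displacement than `f` can gain
from it, and the semigroup property carries this to all times. Continuity in space follows, since
a point at distance `d` is reached at unit speed in time `d`.

The subsolution property results from curves of constant velocity that arrive at the point along
an edge (`deriv_add_mul_le_of_isLocalMax`).

For the supersolution property, suppose that `φ_t + H < 0` at a local minimum of `u - φ`. At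
a vertex, `H` sees only the incoming velocities, whereas a curve may leave the vertex and return.
This is repaired in `exists_slope_of_end`: the test function is lowered on each edge, its slope
being replaced, in the coordinate that starts at the vertex, by the minimum with a subgradient of
`L` at the velocity `0`. Then the strict inequality holds for all velocities, hence, by
superlinearity and compactness, also at the nearby points (`exists_pos_forall_mul_le_of_lt`), and
a function that is slightly lower still, hence below `u` up to a constant, is a calibration near the
point. A nearly optimal curve stays near the point for a short time, so that the calibration
contradicts its near-optimality (`not_forall_exists_isCalibration`).
-/

/-! ### Absolutely continuous curves in pseudometric spaces -/

namespace AbsolutelyContinuousOnInterval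

variable {X : Type*} [PseudoMetricSpace X] {γ γ' : ℝ → X} {a b c : ℝ}

theorem congr (h : AbsolutelyContinuousOnInterval γ a b) (hγ : EqOn γ γ' (uIcc a b)) :
    AbsolutelyContinuousOnInterval γ' a b := by
  rw [absolutelyContinuousOnInterval_iff] at h ⊢
  intro ε hε
  obtain ⟨δ, hδ, H⟩ := h ε hε
  refine ⟨δ, hδ, fun I hI hlt => ?_⟩
  convert H I hI hlt using 1
  refine Finset.sum_congr rfl fun i hi => ?_
  rw [hγ (hI.1 i hi).1, hγ (hI.1 i hi).2]

theorem lipschitz_comp {g : X → ℝ} {K : ℝ} (hg : ∀ x y, |g x - g y| ≤ K * dist x y)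
    (h : AbsolutelyContinuousOnInterval γ a b) :
    AbsolutelyContinuousOnInterval (fun s => g (γ s)) a b := by
  refine squeeze_zero (fun t => Finset.sum_nonneg fun i _ => dist_nonneg) (fun t => ?_)
    (by simpa using Tendsto.const_mul K h)
  rw [Finset.mul_sum]
  exact Finset.sum_le_sum fun i _ => hg _ _

/-- Clamping all intervals at `b` splits the variation of `γ` into its variations on the two
halves, so no interval containing `b` has to be treated separately. -/
theorem trans (hab : a ≤ b) (hbc : b ≤ c) (h : AbsolutelyContinuousOnInterval γ a b)
    (h' : AbsolutelyContinuousOnInterval γ b c) : AbsolutelyContinuousOnInterval γ a c := by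
  rw [absolutelyContinuousOnInterval_iff] at h h' ⊢
  intro ε hε
  obtain ⟨δ, hδ, H⟩ := h (ε / 2) (half_pos hε)
  obtain ⟨δ', hδ', H'⟩ := h' (ε / 2) (half_pos hε)
  refine ⟨min δ δ', lt_min hδ hδ', fun ⟨n, I⟩ hI hlt => ?_⟩
  simp only [disjWithin, uIcc_of_le hab, uIcc_of_le hbc, uIcc_of_le (hab.trans hbc),
    mem_ofPred_eq] at *
  have h1 := H (n, fun i => (min (I i).1 b, min (I i).2 b)) ⟨fun i hi => ?_, ?_⟩ ?_
  have h2 := H' (n, fun i => (max (I i).1 b, max (I i).2 b)) ⟨fun i hi => ?_, ?_⟩ ?_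
  · calc _ ≤ ∑ i ∈ Finset.range n, (dist (γ (min (I i).1 b)) (γ (min (I i).2 b)) +
          dist (γ (max (I i).1 b)) (γ (max (I i).2 b))) := by
          refine Finset.sum_le_sum fun i _ => ?_
          rcases le_total (I i).1 b with h1 | h1 <;> rcases le_total (I i).2 b with h2 | h2 <;>
            simp only [min_eq_left, min_eq_right, max_eq_left, max_eq_right, h1, h2, dist_self,
              add_zero, zero_add, le_refl, dist_triangle]
          rw [add_comm]
          exact dist_triangle _ _ _
      _ < ε := by rw [Finset.sum_add_distrib]; linarith
  · have := hI.1 i hi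
    exact ⟨⟨le_max_right _ _, max_le this.1.2 hbc⟩, ⟨le_max_right _ _, max_le this.2.2 hbc⟩⟩
  · refine hI.2.mono fun i => ?_
    intro x hx
    simp only [mem_uIoc] at hx ⊢
    grind
  · refine lt_of_le_of_lt (Finset.sum_le_sum fun i _ => ?_) (hlt.trans_le (min_le_right _ _))
    simp only [Real.dist_eq]
    exact abs_max_sub_max_le_abs _ _ _
  · have := hI.1 i hi
    exact ⟨⟨le_min this.1.1 hab, min_le_right _ _⟩, ⟨le_min this.2.1 hab, min_le_right _ _⟩⟩
  · refine hI.2.mono fun i => ?_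
    intro x hx
    simp only [mem_uIoc] at hx ⊢
    grind
  · refine lt_of_le_of_lt (Finset.sum_le_sum fun i _ => ?_) (hlt.trans_le (min_le_left _ _))
    simp only [Real.dist_eq]
    have := abs_min_sub_min_le_max (I i).1 b (I i).2 b
    simpa using this

theorem comp_add_right (d : ℝ) (h : AbsolutelyContinuousOnInterval γ (a + d) (b + d)) :
    AbsolutelyContinuousOnInterval (fun s => γ (s + d)) a b := by
  rw [absolutelyContinuousOnInterval_iff] at h ⊢
  intro ε hε
  obtain ⟨δ, hδ, H⟩ := h ε hε
  refine ⟨δ, hδ, fun ⟨n, I⟩ hI hlt => ?_⟩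
  refine H (n, fun i => ((I i).1 + d, (I i).2 + d)) ⟨fun i hi => ?_, fun i hi k hk hik => ?_⟩ ?_
  · have := hI.1 i hi
    simp only [mem_uIcc] at this ⊢
    constructor <;> grind
  · have := hI.2 hi hk hik
    simp only [Function.onFun, disjoint_left, mem_uIoc] at this ⊢
    intro x hx hx'
    refine this (a := x - d) ?_ ?_ <;> grind
  · simpa using hlt

theorem continuousAt_of_mem_Ioo (h : AbsolutelyContinuousOnInterval γ a b) {τ : ℝ}
    (hτ : τ ∈ Ioo a b) : ContinuousAt γ τ := by
  have hd := (h.lipschitz_comp (g := fun x => dist x (γ τ)) (K := 1)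
    fun x y => by simpa using abs_dist_sub_le x y (γ τ)).continuousOn
  rw [uIcc_of_le (hτ.1.trans hτ.2).le] at hd
  have := hd.continuousAt (Icc_mem_nhds hτ.1 hτ.2)
  refine tendsto_iff_dist_tendsto_zero.2 ?_
  simpa [ContinuousAt] using this

end AbsolutelyContinuousOnInterval

/-- On a level set of any real function the derivative vanishes almost everywhere: only countably
many points of the level set are isolated from the right in it, and at every other one a nonzero
derivative is impossible. -/
theorem ae_deriv_eq_zero_of_eq_const (h : ℝ → ℝ) (c : ℝ) : ∀ᵐ τ, h τ = c → deriv h τ = 0 := by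
  have hc : {x ∈ {s | h s = c} | 𝓝[{s | h s = c} ∩ Ioi x] x = ⊥}.Countable :=
    countable_setOfPred_isolated_right_within
  filter_upwards [hc.ae_notMem volume] with τ hτ hτc
  have hne : (𝓝[{s | h s = c} ∩ Ioi τ] τ).NeBot := ⟨fun hbot => hτ ⟨hτc, hbot⟩⟩
  by_cases hd : DifferentiableAt ℝ h τ
  · have hs := hd.hasDerivAt.tendsto_slope.mono_left
      (nhdsWithin_mono τ (s := {s | h s = c} ∩ Ioi τ) fun x hx => ne_of_gt hx.2)
    refine tendsto_nhds_unique hs (tendsto_const_nhds.congr' ?_)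
    filter_upwards [self_mem_nhdsWithin] with x hx
    have : h x = c := hx.1
    simp [slope, hτc, this]
  · exact deriv_zero_of_not_differentiableAt hd

/-! ### The topology of a finite metric graph -/

namespace MetricGraph

variable {V E : Type*} {G : MetricGraph V E}

theorem dist_pt_le {j : E} {a b : ℝ} (ha : a ∈ Icc 0 (G.len j)) (hb : b ∈ Icc 0 (G.len j)) :
    dist (G.pt j a) (G.pt j b) ≤ |b - a| :=
  csInf_le ⟨0, fun _ h => PathLength.nonneg h⟩ (PathLength.segment ha hb)

theorem lipschitzOnWith_pt (j : E) : LipschitzOnWith 1 (G.pt j) (Icc 0 (G.len j)) :=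
  LipschitzOnWith.of_dist_le_mul fun a ha b hb => by
    simpa [Real.dist_eq, abs_sub_comm a b] using dist_pt_le ha hb

/-- A function on `G` is Lipschitz if it is so along every edge. -/
theorem abs_sub_le_of_forall_pt {g : G.Pt → ℝ} {K : ℝ} (hK : 0 ≤ K)
    (hg : ∀ j, ∀ a ∈ Icc 0 (G.len j), ∀ b ∈ Icc 0 (G.len j),
      |g (G.pt j b) - g (G.pt j a)| ≤ K * |b - a|) (P Q : G.Pt) :
    |g P - g Q| ≤ K * dist P Q := by
  have key : ∀ P Q ℓ, G.PathLength P Q ℓ → |g P - g Q| ≤ K * ℓ := by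
    intro P Q ℓ h
    induction h with
    | refl => simp
    | step ha hb _ ih =>
      have := hg _ _ ha _ hb
      rw [mul_add, abs_sub_comm]
      rw [abs_sub_comm] at ih
      exact (abs_sub_le _ _ _).trans (by linarith)
  rcases hK.eq_or_lt with rfl | hK
  · obtain ⟨ℓ, h⟩ := G.exists_pathLength P Q
    simpa using key _ _ _ h
  · rw [← div_le_iff₀' hK]
    exact le_csInf (G.exists_pathLength P Q) fun ℓ h => (div_le_iff₀' hK).2 (key _ _ _ h)

/-- The function on `G` that is `c` on the vertices and `φ j` on the open edge `j`. It is well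
behaved only if the boundary values of `φ j` agree with `c`; this is a hypothesis of the lemmas. -/
def glue (G : MetricGraph V E) (c : V → ℝ) (φ : E → ℝ → ℝ) : G.Pt → ℝ
  | .vertex v => c v
  | .inner j x _ => φ j x

theorem glue_pt {c : V → ℝ} {φ : E → ℝ → ℝ} {j : E} (h₀ : φ j 0 = c (G.src j))
    (h₁ : φ j (G.len j) = c (G.tgt j)) {x : ℝ} (hx : x ∈ Icc 0 (G.len j)) :
    glue G c φ (G.pt j x) = φ j x := by
  rcases hx.1.eq_or_lt with rfl | h
  · rw [pt_zero, h₀]; rfl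
  · rcases hx.2.eq_or_lt with rfl | h'
    · rw [pt_len, h₁]; rfl
    · rw [pt_inner _ _ _ ⟨h, h'⟩]; rfl

theorem abs_glue_sub_glue_le {c : V → ℝ} {φ : E → ℝ → ℝ} {K : ℝ} (hK : 0 ≤ K)
    (h₀ : ∀ j, φ j 0 = c (G.src j)) (h₁ : ∀ j, φ j (G.len j) = c (G.tgt j))
    (hφ : ∀ j, ∀ a ∈ Icc 0 (G.len j), ∀ b ∈ Icc 0 (G.len j), |φ j b - φ j a| ≤ K * |b - a|)
    (P Q : G.Pt) : |glue G c φ P - glue G c φ Q| ≤ K * dist P Q := by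
  refine abs_sub_le_of_forall_pt hK (fun j a ha b hb => ?_) P Q
  rw [glue_pt (h₀ j) (h₁ j) ha, glue_pt (h₀ j) (h₁ j) hb]
  exact hφ j a ha b hb

/-- A ball around a point of an open edge that is too small to reach the ends of the edge lies in
the edge, and the distance to its centre is bounded from below by the difference of the
coordinates. The tent of slope one on the edge is the test function that shows this. -/
theorem exists_inner_of_dist_lt {j : E} {x : ℝ} (hx : x ∈ Ioo 0 (G.len j)) {Q : G.Pt}
    (hQ : dist Q (Pt.inner j x hx) < min x (G.len j - x)) :
    ∃ y hy, Q = Pt.inner j y hy ∧ |y - x| ≤ dist Q (Pt.inner j x hx) := by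
  classical
  set r := min x (G.len j - x) with hr
  have hr0 : r ≤ x := min_le_left _ _
  have hr1 : r ≤ G.len j - x := min_le_right _ _
  let φ : E → ℝ → ℝ := fun k y => if k = j then max 0 (r - |y - x|) else 0
  have hlip := abs_glue_sub_glue_le (G := G) (c := fun _ => 0) (φ := φ) (K := 1) zero_le_one
    (fun k => ?_) (fun k => ?_) (fun k a _ b _ => ?_) (Pt.inner j x hx) Q
  · have hP : glue G (fun _ => 0) φ (Pt.inner j x hx) = r := by
      have : 0 ≤ r := le_min hx.1.le (by linarith [hx.2])
      simp [glue, φ, this]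
    rw [hP, one_mul, dist_comm] at hlip
    have hpos : 0 < glue G (fun _ => 0) φ Q := by
      linarith [le_abs_self (r - glue G (fun _ => 0) φ Q)]
    rcases Q with v | ⟨k, y, hy⟩
    · simp [glue] at hpos
    · by_cases hk : k = j
      · subst hk
        refine ⟨y, hy, rfl, ?_⟩
        simp only [glue, φ, if_true] at hpos hlip
        rcases max_cases 0 (r - |y - x|) with h | h
        · linarith [h.1]
        · rw [h.1] at hlip
          linarith [le_abs_self (r - (r - |y - x|))]
      · simp [glue, φ, hk] at hpos
  · by_cases hk : k = j
    · simp only [φ, hk, if_true, zero_sub, abs_neg, abs_of_pos hx.1]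
      exact max_eq_left (by linarith)
    · simp [φ, hk]
  · by_cases hk : k = j
    · subst hk
      simp only [φ, if_true]
      rw [abs_of_pos (by linarith [hx.2] : 0 < G.len k - x)]
      exact max_eq_left (by linarith)
    · simp [φ, hk]
  · by_cases hk : k = j
    · simp only [φ, hk, if_true, one_mul]
      rw [max_comm 0, max_comm 0]
      refine (abs_max_sub_max_le_abs _ _ _).trans ?_
      have := abs_abs_sub_abs_le (a - x) (b - x)
      rw [abs_sub_comm b a]
      simpa [abs_sub_comm] using this
    · simp [φ, hk]

/-- In a ball around a vertex that is smaller than all edges, there are only the vertex itself and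
initial segments of the edges at this vertex. -/
theorem eq_vertex_or_exists_inner_of_dist_lt {m : ℝ} (hm : ∀ j, m ≤ G.len j) {v : V} {Q : G.Pt}
    (hQ : dist Q (Pt.vertex v) < m) : Q = Pt.vertex v ∨ ∃ j y hy, Q = Pt.inner j y hy ∧
      ((G.src j = v ∧ y ≤ dist Q (Pt.vertex v)) ∨
        (G.tgt j = v ∧ G.len j - y ≤ dist Q (Pt.vertex v))) := by
  classical
  have hm0 : 0 < m := dist_nonneg.trans_lt hQ
  let c : V → ℝ := fun w => if w = v then m else 0
  let φ : E → ℝ → ℝ := fun k y => max 0 (max (c (G.src k) - y) (c (G.tgt k) - (G.len k - y)))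
  have hc0 : ∀ w, 0 ≤ c w := fun w => by simp only [c]; split_ifs <;> linarith
  have hcm : ∀ w, c w ≤ m := fun w => by simp only [c]; split_ifs <;> linarith
  have hlip := abs_glue_sub_glue_le (G := G) (c := c) (φ := φ) (K := 1) zero_le_one
    (fun k => ?_) (fun k => ?_) (fun k a _ b _ => ?_) (Pt.vertex v) Q
  · have hP : glue G c φ (Pt.vertex v) = m := by simp [glue, c]
    rw [hP, one_mul, dist_comm] at hlip
    have hpos : m - dist Q (Pt.vertex v) ≤ glue G c φ Q := by
      linarith [le_abs_self (m - glue G c φ Q)]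
    rcases Q with w | ⟨k, y, hy⟩
    · left
      by_contra hne
      have : w ≠ v := fun h => hne (by rw [h])
      simp only [glue, c, this, if_false] at hpos
      linarith
    · right
      refine ⟨k, y, hy, rfl, ?_⟩
      simp only [glue, φ, le_max_iff] at hpos
      rcases hpos with h | h | h
      · linarith
      · left
        by_cases hs : G.src k = v
        · simp only [c, hs, if_true] at h
          exact ⟨hs, by linarith⟩
        · simp only [c, hs, if_false] at h
          linarith [hy.1]
      · right
        by_cases hs : G.tgt k = v
        · simp only [c, hs, if_true] at h
          exact ⟨hs, by linarith⟩
        · simp only [c, hs, if_false] at h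
          linarith [hy.2]
  · have := hcm (G.tgt k)
    simp only [φ, sub_zero]
    rw [max_eq_left (a := c (G.src k)) (by linarith [hm k, hc0 (G.src k)])]
    exact max_eq_right (hc0 _)
  · have := hcm (G.src k)
    simp only [φ, sub_self, sub_zero]
    rw [max_eq_right (a := c (G.src k) - G.len k) (by linarith [hm k, hc0 (G.tgt k)])]
    exact max_eq_right (hc0 _)
  · simp only [φ, one_mul]
    rw [max_comm 0, max_comm 0]
    refine (abs_max_sub_max_le_abs _ _ _).trans ((abs_max_sub_max_le_max _ _ _ _).trans ?_)
    refine max_le ?_ ?_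
    · rw [abs_sub_comm]
      exact le_of_eq (by congr 1; ring)
    · exact le_of_eq (by congr 1; ring)

theorem pt_eq_inner {j k : E} {x y : ℝ} {hy : y ∈ Ioo 0 (G.len k)}
    (h : G.pt j x = Pt.inner k y hy) : j = k ∧ x = y := by
  unfold pt at h
  split_ifs at h
  injection h with h1 h2
  exact ⟨h1, h2⟩

theorem pt_eq_vertex {j : E} {x : ℝ} (hx : x ∈ Icc 0 (G.len j)) {v : V}
    (h : G.pt j x = Pt.vertex v) : (x = 0 ∧ G.src j = v) ∨ (x = G.len j ∧ G.tgt j = v) := by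
  unfold pt at h
  split_ifs at h with h0 h1
  · injection h with h
    exact Or.inl ⟨le_antisymm h0 hx.1, h⟩
  · injection h with h
    exact Or.inr ⟨le_antisymm hx.2 h1, h⟩

theorem exists_src_eq_or_tgt_eq [Nonempty E] (G : MetricGraph V E) (v : V) :
    ∃ j, G.src j = v ∨ G.tgt j = v := by
  have key : ∀ a b, Relation.EqvGen (fun a b => ∃ j, G.src j = a ∧ G.tgt j = b) a b →
      a = b ∨ ((∃ j, G.src j = a ∨ G.tgt j = a) ∧ ∃ j, G.src j = b ∨ G.tgt j = b) := by
    intro a b h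
    induction h with
    | rel a b h => obtain ⟨j, ha, hb⟩ := h; exact Or.inr ⟨⟨j, .inl ha⟩, ⟨j, .inr hb⟩⟩
    | refl => exact Or.inl rfl
    | symm a b _ ih => exact ih.imp Eq.symm And.symm
    | trans a b c _ _ ih₁ ih₂ =>
      rcases ih₁ with rfl | h₁
      · exact ih₂
      · rcases ih₂ with rfl | h₂
        · exact Or.inr h₁
        · exact Or.inr ⟨h₁.1, h₂.2⟩
  obtain ⟨j⟩ := ‹Nonempty E›
  rcases key _ _ (G.connected (G.src j) v) with h | h
  · exact ⟨j, .inl h⟩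
  · exact h.2

theorem exists_pt_eq [Nonempty E] (P : G.Pt) : ∃ j, ∃ x ∈ Icc 0 (G.len j), G.pt j x = P := by
  rcases P with v | ⟨j, x, hx⟩
  · obtain ⟨j, h | h⟩ := G.exists_src_eq_or_tgt_eq v
    · exact ⟨j, 0, ⟨le_rfl, (G.len_pos j).le⟩, by rw [pt_zero, h]⟩
    · exact ⟨j, G.len j, ⟨(G.len_pos j).le, le_rfl⟩, by rw [pt_len, h]⟩
  · exact ⟨j, x, ⟨hx.1.le, hx.2.le⟩, G.pt_inner j x hx⟩

theorem exists_pos_le_len [Finite E] (G : MetricGraph V E) : ∃ m > 0, ∀ j, m ≤ G.len j := by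
  cases isEmpty_or_nonempty E
  · exact ⟨1, one_pos, fun j => isEmptyElim j⟩
  · obtain ⟨j, hj⟩ := Finite.exists_min G.len
    exact ⟨_, G.len_pos j, hj⟩

/-- Points close to `P` lie on an edge through `P`, at a coordinate close to that of `P`. -/
theorem exists_pt_eq_pt_eq_of_dist_lt [Finite E] [Nonempty E] (P : G.Pt) : ∃ r > 0, ∀ Q : G.Pt,
    dist Q P < r → ∃ j, ∃ x ∈ Icc 0 (G.len j), ∃ y ∈ Icc 0 (G.len j),
      G.pt j x = P ∧ G.pt j y = Q ∧ |y - x| ≤ dist Q P := by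
  rcases P with v | ⟨j, x, hx⟩
  · obtain ⟨m, hm0, hm⟩ := G.exists_pos_le_len
    refine ⟨m, hm0, fun Q hQ => ?_⟩
    rcases eq_vertex_or_exists_inner_of_dist_lt hm hQ with rfl | ⟨j, y, hy, rfl, h | h⟩
    · obtain ⟨j, x, hx, hP⟩ := exists_pt_eq (G := G) (Pt.vertex v)
      exact ⟨j, x, hx, x, hx, hP, hP, by simp⟩
    · refine ⟨j, 0, ⟨le_rfl, (G.len_pos j).le⟩, y, ⟨hy.1.le, hy.2.le⟩, ?_, G.pt_inner j y hy, ?_⟩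
      · rw [pt_zero, h.1]
      · rw [sub_zero, abs_of_pos hy.1]; exact h.2
    · refine ⟨j, G.len j, ⟨(G.len_pos j).le, le_rfl⟩, y, ⟨hy.1.le, hy.2.le⟩, ?_,
        G.pt_inner j y hy, ?_⟩
      · rw [pt_len, h.1]
      · rw [abs_sub_comm, abs_of_pos (sub_pos.2 hy.2)]; exact h.2
  · refine ⟨min x (G.len j - x), lt_min hx.1 (sub_pos.2 hx.2), fun Q hQ => ?_⟩
    obtain ⟨y, hy, rfl, h⟩ := exists_inner_of_dist_lt hx hQ
    exact ⟨j, x, ⟨hx.1.le, hx.2.le⟩, y, ⟨hy.1.le, hy.2.le⟩, G.pt_inner j x hx,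
      G.pt_inner j y hy, h⟩

instance [Finite E] [Nonempty E] : CompactSpace G.Pt := by
  refine ⟨?_⟩
  have : (univ : Set G.Pt) = ⋃ j, G.pt j '' Icc 0 (G.len j) := by
    refine (eq_univ_of_forall fun P => ?_).symm
    obtain ⟨j, x, hx, rfl⟩ := exists_pt_eq P
    exact mem_iUnion.2 ⟨j, x, hx, rfl⟩
  rw [this]
  exact isCompact_iUnion fun j =>
    isCompact_Icc.image_of_continuousOn (lipschitzOnWith_pt j).continuousOn

/-- A curve that is continuous at a time at which it is inside an edge stays inside that edge for a
while, and its coordinate is continuous there. -/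
theorem eventually_inner_of_continuousAt {γ : ℝ → G.Pt} {τ : ℝ} (hγ : ContinuousAt γ τ) {j : E}
    {x : ℝ} {hx : x ∈ Ioo 0 (G.len j)} (h : γ τ = Pt.inner j x hx) :
    (∀ᶠ s in 𝓝 τ, ∃ hs : (γ s).coord ∈ Ioo 0 (G.len j), γ s = Pt.inner j (γ s).coord hs) ∧
      ContinuousAt (fun s => (γ s).coord) τ := by
  have hev : ∀ ε > 0, ∀ᶠ s in 𝓝 τ,
      (∃ hs : (γ s).coord ∈ Ioo 0 (G.len j), γ s = Pt.inner j (γ s).coord hs) ∧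
        |(γ s).coord - x| < ε := by
    intro ε hε
    have hr : 0 < min ε (min x (G.len j - x)) := lt_min hε (lt_min hx.1 (sub_pos.2 hx.2))
    filter_upwards [Metric.tendsto_nhds.1 hγ _ hr] with s hs
    rw [h] at hs
    obtain ⟨y, hy, hQ, hle⟩ := exists_inner_of_dist_lt hx (hs.trans_le (min_le_right _ _))
    have hc : (γ s).coord = y := by rw [hQ]; rfl
    rw [hc]
    exact ⟨⟨hy, hQ⟩, hle.trans_lt (hs.trans_le (min_le_left _ _))⟩
  refine ⟨(hev 1 one_pos).mono fun s hs => hs.1, Metric.tendsto_nhds.2 fun ε hε => ?_⟩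
  have hc : (γ τ).coord = x := by rw [h]; rfl
  show ∀ᶠ s in 𝓝 τ, dist (γ s).coord (γ τ).coord < ε
  rw [hc]
  exact (hev ε hε).mono fun s hs => hs.2

end MetricGraph

/-! ### Calibrations: lower bounds for the action of a curve -/

namespace MetricGraph

variable {V E : Type*} {G : MetricGraph V E}

/-- The coordinate of an absolutely continuous curve is differentiable at almost all the times at
which the curve is inside an edge. The tent functions `min (c * y) (len - y)`, which extend to
Lipschitz functions on the graph, are local coordinates except at their peaks; two values of `c`
with different peaks suffice. -/
theorem ae_differentiableAt_coord [Finite E] {γ : ℝ → G.Pt} {a b : ℝ}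
    (hγ : AbsolutelyContinuousOnInterval γ a b) :
    ∀ᵐ τ, τ ∈ Ioo a b → ∀ j x hx, γ τ = Pt.inner j x hx →
      DifferentiableAt ℝ (fun s => (γ s).coord) τ := by
  classical
  let T : E → ℝ → G.Pt → ℝ := fun j c =>
    glue G (fun _ => 0) fun k y => if k = j then min (c * y) (G.len j - y) else 0
  have hT : ∀ j, ∀ c, 1 ≤ c → ∀ᵐ τ, τ ∈ uIcc a b → DifferentiableAt ℝ (fun s => T j c (γ s)) τ := by
    intro j c hc
    refine (AbsolutelyContinuousOnInterval.lipschitz_comp (K := c)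
      (abs_glue_sub_glue_le (by linarith) (fun k => ?_) (fun k => ?_) fun k x _ y _ => ?_)
      hγ).ae_differentiableAt
    · by_cases hk : k = j
      · simp [hk, (G.len_pos j).le]
      · simp [hk]
    · by_cases hk : k = j
      · simp only [hk, if_true, sub_self]
        exact min_eq_right (mul_nonneg (by linarith) (G.len_pos j).le)
      · simp [hk]
    · by_cases hk : k = j
      · simp only [hk, if_true]
        refine (abs_min_sub_min_le_max _ _ _ _).trans (max_le ?_ ?_)
        · rw [← mul_sub, abs_mul, abs_of_nonneg (by linarith)]
        · rw [sub_sub_sub_cancel_left, abs_sub_comm]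
          exact le_mul_of_one_le_left (abs_nonneg _) hc
      · simp only [hk, if_false, sub_self, abs_zero]
        exact mul_nonneg (by linarith) (abs_nonneg _)
  filter_upwards [ae_all_iff.2 fun j => hT j 1 le_rfl, ae_all_iff.2 fun j => hT j 2 one_le_two]
    with τ h1 h2 hτ j x hx hγτ
  have hτ' : τ ∈ uIcc a b := Icc_subset_uIcc (Ioo_subset_Icc_self hτ)
  obtain ⟨hev, hcont⟩ := eventually_inner_of_continuousAt
    (hγ.continuousAt_of_mem_Ioo hτ) hγτ
  have hx0 : (γ τ).coord = x := by rw [hγτ]; rfl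
  have hval : ∀ c, ∀ᶠ s in 𝓝 τ, T j c (γ s) = min (c * (γ s).coord) (G.len j - (γ s).coord) := by
    intro c
    filter_upwards [hev] with s ⟨hs, hγs⟩
    conv_lhs => rw [hγs]
    simp [T, glue]
  have main : ∀ c, 0 < c → c * x ≠ G.len j - x →
      DifferentiableAt ℝ (fun s => T j c (γ s)) τ →
        DifferentiableAt ℝ (fun s => (γ s).coord) τ := by
    intro c hc hne hd
    have hl : ContinuousAt (fun s => c * (γ s).coord) τ := continuousAt_const.mul hcont
    have hr : ContinuousAt (fun s => G.len j - (γ s).coord) τ := continuousAt_const.sub hcont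
    rcases lt_or_gt_of_ne hne with h | h
    · have : ∀ᶠ s in 𝓝 τ, c * (γ s).coord < G.len j - (γ s).coord :=
        hl.eventually_lt hr (by simpa [hx0] using h)
      refine (hd.const_mul c⁻¹).congr_of_eventuallyEq ?_
      filter_upwards [this, hval c] with s hs hv
      rw [hv, min_eq_left hs.le, inv_mul_cancel_left₀ hc.ne']
    · have : ∀ᶠ s in 𝓝 τ, G.len j - (γ s).coord < c * (γ s).coord :=
        hr.eventually_lt hl (by simpa [hx0] using h)
      refine (hd.const_sub (G.len j)).congr_of_eventuallyEq ?_
      filter_upwards [this, hval c] with s hs hv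
      rw [hv, min_eq_right hs.le, sub_sub_cancel]
  by_cases hmid : 1 * x = G.len j - x
  · refine main 2 two_pos (fun h => ?_) (h2 j hτ')
    linarith [hx.1]
  · exact main 1 one_pos hmid (h1 j hτ')

theorem deriv_comp_eq_of_inner {γ : ℝ → G.Pt} {τ : ℝ} (hγ : ContinuousAt γ τ) {j : E} {x : ℝ}
    {hx : x ∈ Ioo 0 (G.len j)} (h : γ τ = Pt.inner j x hx)
    (hd : DifferentiableAt ℝ (fun s => (γ s).coord) τ) {g : G.Pt → ℝ} {p : ℝ}
    (hg : HasDerivAt (fun y => g (G.pt j y)) p x) :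
    deriv (fun s => g (γ s)) τ = p * deriv (fun s => (γ s).coord) τ := by
  obtain ⟨hev, -⟩ := eventually_inner_of_continuousAt hγ h
  have hx0 : (γ τ).coord = x := by rw [h]; rfl
  rw [← hx0] at hg
  refine HasDerivAt.deriv ((hg.comp τ hd.hasDerivAt).congr_of_eventuallyEq ?_)
  filter_upwards [hev] with s ⟨hs, hγs⟩
  conv_lhs => rw [hγs]
  simp only [Function.comp]
  rw [pt_inner _ _ _ hs]

theorem abs_deriv_comp_le_of_inner {γ : ℝ → G.Pt} {τ : ℝ} (hγ : ContinuousAt γ τ) {j : E} {x : ℝ}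
    {hx : x ∈ Ioo 0 (G.len j)} (h : γ τ = Pt.inner j x hx)
    (hd : DifferentiableAt ℝ (fun s => (γ s).coord) τ) {g : G.Pt → ℝ} {K : ℝ} (hK : 0 ≤ K)
    (hg : ∀ P Q, |g P - g Q| ≤ K * dist P Q) :
    |deriv (fun s => g (γ s)) τ| ≤ K * |deriv (fun s => (γ s).coord) τ| := by
  by_cases hd' : DifferentiableAt ℝ (fun s => g (γ s)) τ
  · obtain ⟨hev, -⟩ := eventually_inner_of_continuousAt hγ h
    refine le_of_tendsto_of_tendsto hd'.hasDerivAt.tendsto_slope.abs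
      (hd.hasDerivAt.tendsto_slope.abs.const_mul K) ?_
    filter_upwards [hev.filter_mono nhdsWithin_le_nhds] with s ⟨hs, hγs⟩
    simp only [slope_def_field, abs_div, mul_div_assoc']
    gcongr
    have hτ' := hev.self_of_nhds
    refine (hg _ _).trans (mul_le_mul_of_nonneg_left ?_ hK)
    obtain ⟨ht, hγt⟩ := hτ'
    calc dist (γ s) (γ τ) = dist (G.pt j (γ s).coord) (G.pt j (γ τ).coord) := by
          rw [pt_inner _ _ _ hs, pt_inner _ _ _ ht, ← hγs, ← hγt]
      _ ≤ |(γ τ).coord - (γ s).coord| :=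
          dist_pt_le (Ioo_subset_Icc_self hs) (Ioo_subset_Icc_self ht)
      _ = _ := abs_sub_comm _ _
  · rw [deriv_zero_of_not_differentiableAt hd', abs_zero]
    positivity

namespace Lagrangian

variable {L : G.Lagrangian}

theorem along_of_eq_inner {γ : ℝ → G.Pt} {τ : ℝ} {j : E} {x : ℝ} {hx : x ∈ Ioo 0 (G.len j)}
    (h : γ τ = Pt.inner j x hx) :
    L.along γ τ = L.toFun j x (deriv (fun s => (γ s).coord) τ) := by
  unfold along; rw [h]

theorem along_of_eq_vertex {γ : ℝ → G.Pt} {τ : ℝ} {v : V} (h : γ τ = Pt.vertex v) :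
    L.along γ τ = L.rest v := by
  unfold along; rw [h]

/-- A Lipschitz function `g` whose derivative along `γ` is at most `L + c` bounds the action of `γ`
from below. At the times at which `γ` is at a vertex, only `0 ≤ L + c` is needed, as the derivative
of `g ∘ γ` vanishes at almost all of them. -/
theorem sub_le_integral_along [Finite V] [Finite E] {γ : ℝ → G.Pt} {a b : ℝ} (hab : a ≤ b)
    (hγ : AbsolutelyContinuousOnInterval γ a b)
    (hint : IntervalIntegrable (L.along γ) volume a b) {g : G.Pt → ℝ} {K c : ℝ}
    (hg : ∀ P Q, |g P - g Q| ≤ K * dist P Q)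
    (hv : ∀ τ ∈ Ioo a b, ∀ v, γ τ = Pt.vertex v → 0 ≤ L.rest v + c)
    (hi : ∀ τ ∈ Ioo a b, ∀ j x hx, γ τ = Pt.inner j x hx →
      DifferentiableAt ℝ (fun s => (γ s).coord) τ →
      deriv (fun s => g (γ s)) τ ≤ L.toFun j x (deriv (fun s => (γ s).coord) τ) + c) :
    g (γ b) - g (γ a) ≤ (∫ t in a..b, L.along γ t) + c * (b - a) := by
  have hac := AbsolutelyContinuousOnInterval.lipschitz_comp hg hγ
  rw [← hac.integral_deriv_eq_sub, mul_comm, ← smul_eq_mul (b - a),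
    ← intervalIntegral.integral_const, ← intervalIntegral.integral_add hint (by simp)]
  refine intervalIntegral.integral_mono_ae_restrict hab hac.intervalIntegrable_deriv
    (hint.add (by simp)) ?_
  rw [Measure.restrict_congr_set Ioo_ae_eq_Icc.symm]
  refine (ae_restrict_iff' measurableSet_Ioo).2 ?_
  filter_upwards [ae_differentiableAt_coord hγ,
    ae_all_iff.2 fun v : V => ae_deriv_eq_zero_of_eq_const (fun s => g (γ s)) (g (Pt.vertex v))]
    with τ h1 h2 hτ
  rcases hP : γ τ with v | ⟨j, x, hx⟩
  · simp only [h2 v (by rw [hP]), along_of_eq_vertex hP]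
    exact hv τ hτ v hP
  · simp only [along_of_eq_inner hP]
    exact hi τ hτ j x hx hP (h1 hτ j x hx hP)

theorem sub_le_integral_along_of_hasDerivAt [Finite V] [Finite E] {γ : ℝ → G.Pt} {a b : ℝ}
    (hab : a ≤ b) (hγ : AbsolutelyContinuousOnInterval γ a b)
    (hint : IntervalIntegrable (L.along γ) volume a b) {g : G.Pt → ℝ} {K c : ℝ}
    (hg : ∀ P Q, |g P - g Q| ≤ K * dist P Q)
    (hv : ∀ τ ∈ Ioo a b, ∀ v, γ τ = Pt.vertex v → 0 ≤ L.rest v + c)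
    (hi : ∀ τ ∈ Ioo a b, ∀ j x hx, γ τ = Pt.inner j x hx →
      ∃ p, HasDerivAt (fun y => g (G.pt j y)) p x ∧ ∀ w, p * w ≤ L.toFun j x w + c) :
    g (γ b) - g (γ a) ≤ (∫ t in a..b, L.along γ t) + c * (b - a) := by
  refine sub_le_integral_along hab hγ hint hg hv fun τ hτ j x hx hP hd => ?_
  obtain ⟨p, hp, hle⟩ := hi τ hτ j x hx hP
  rw [deriv_comp_eq_of_inner (hγ.continuousAt_of_mem_Ioo hτ) hP hd hp]
  exact hle _

theorem exists_toFun_zero_eq_rest [Nonempty E] (L : G.Lagrangian) (v : V) :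
    ∃ j, ∃ x ∈ Icc 0 (G.len j), G.pt j x = Pt.vertex v ∧ L.toFun j x 0 = L.rest v := by
  obtain ⟨j, x, hx, hP⟩ := exists_pt_eq (G := G) (Pt.vertex v)
  refine ⟨j, x, hx, hP, ?_⟩
  rcases pt_eq_vertex hx hP with ⟨rfl, rfl⟩ | ⟨rfl, rfl⟩
  · exact L.rest_src j
  · exact L.rest_tgt j

/-- The calibrations by multiples of the distance: a displacement in a short time is expensive. -/
theorem mul_dist_le_integral_along [Finite V] [Finite E] [Nonempty E] {γ : ℝ → G.Pt} {a b : ℝ}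
    (hab : a ≤ b) (hγ : AbsolutelyContinuousOnInterval γ a b)
    (hint : IntervalIntegrable (L.along γ) volume a b) {M C : ℝ} (hM : 0 ≤ M)
    (hC : ∀ j, ∀ x ∈ Icc 0 (G.len j), ∀ v, M * |v| - C ≤ L.toFun j x v) :
    M * dist (γ a) (γ b) ≤ (∫ t in a..b, L.along γ t) + C * (b - a) := by
  have hg : ∀ P Q : G.Pt, |M * dist (γ a) P - M * dist (γ a) Q| ≤ M * dist P Q := by
    intro P Q
    rw [← mul_sub, abs_mul, abs_of_nonneg hM]
    refine mul_le_mul_of_nonneg_left ?_ hM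
    rw [dist_comm _ P, dist_comm _ Q]
    exact abs_dist_sub_le _ _ _
  have := sub_le_integral_along (L := L) (c := C) hab hγ hint hg (fun τ _ v _ => ?_)
    fun τ hτ j x hx hP hd => ?_
  · simpa using this
  · obtain ⟨j, x, hx, -, h⟩ := L.exists_toFun_zero_eq_rest v
    have := hC j x hx 0
    rw [h, abs_zero] at this
    linarith
  · have h1 := abs_deriv_comp_le_of_inner
      (hγ.continuousAt_of_mem_Ioo hτ) hP hd hM hg
    have h2 := hC j x (Ioo_subset_Icc_self hx) (deriv (fun s => (γ s).coord) τ)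
    linarith [le_abs_self (deriv (fun s => M * dist (γ a) (γ s)) τ)]

end Lagrangian

end MetricGraph

/-! ### Estimates for the Lagrangian and the Hamiltonian -/

/-- A convex function has a subgradient at `0`. -/
theorem ConvexOn.exists_forall_add_mul_le {h : ℝ → ℝ} (hh : ConvexOn ℝ univ h) :
    ∃ q, ∀ w, h 0 + q * w ≤ h w := by
  refine ⟨derivWithin h (Ioi 0) 0, fun w => ?_⟩
  rcases lt_trichotomy w 0 with hw | rfl | hw
  · have h1 := (hh.slope_le_leftDeriv_of_mem_interior (mem_univ w) (by simp) hw).trans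
      (hh.leftDeriv_le_rightDeriv_of_mem_interior (x := 0) (by simp))
    rw [slope_def_field, div_le_iff₀ (by linarith)] at h1
    linarith
  · simp
  · have h1 := hh.rightDeriv_le_slope_of_mem_interior (x := 0) (by simp) (mem_univ w) hw
    rw [slope_def_field, le_div_iff₀ (by linarith)] at h1
    linarith

theorem ConvexOn.add_mul_le_of_one_le {h : ℝ → ℝ} (hh : ConvexOn ℝ univ h) {s t m : ℝ}
    (ht : 1 ≤ t) (hs : h 0 + m ≤ h s) : h 0 + t * m ≤ h (t * s) := by
  have ht0 : 0 < t := by linarith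
  have h1 := hh.2 (mem_univ (t * s)) (mem_univ 0) (inv_nonneg.2 ht0.le)
    (sub_nonneg.2 (inv_le_one_of_one_le₀ ht)) (by ring)
  simp only [smul_eq_mul, mul_zero, add_zero, inv_mul_cancel_left₀ ht0.ne'] at h1
  have h2 := mul_le_mul_of_nonneg_left (hs.trans h1) ht0.le
  have h3 : t * (t⁻¹ * h (t * s) + (1 - t⁻¹) * h 0) = h (t * s) + (t - 1) * h 0 := by
    field_simp
  rw [h3] at h2
  linarith

namespace MetricGraph

variable {V E : Type*} {G : MetricGraph V E}

namespace Lagrangian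

theorem continuousOn_toFun (L : G.Lagrangian) (j : E) :
    ContinuousOn (fun q : ℝ × ℝ => L.toFun j q.1 q.2) (Icc 0 (G.len j) ×ˢ univ) :=
  (L.contDiffOn j).continuousOn

theorem exists_forall_abs_le (L : G.Lagrangian) (j : E) (R : ℝ) :
    ∃ B, ∀ x ∈ Icc 0 (G.len j), ∀ w, |w| ≤ R → |L.toFun j x w| ≤ B := by
  obtain ⟨B, hB⟩ :=
    (isCompact_Icc.prod (isCompact_Icc (a := -R) (b := R))).exists_bound_of_continuousOn
    ((L.continuousOn_toFun j).mono (prod_mono_right (subset_univ _)))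
  exact ⟨B, fun x hx w hw => hB (x, w) ⟨hx, abs_le.1 hw⟩⟩

theorem exists_forall_le_of_abs_le [Finite E] (L : G.Lagrangian) (R : ℝ) :
    ∃ B, ∀ j, ∀ x ∈ Icc 0 (G.len j), ∀ w, |w| ≤ R → L.toFun j x w ≤ B := by
  choose B hB using fun j => L.exists_forall_abs_le j R
  obtain ⟨M, hM⟩ := (finite_range B).bddAbove
  exact ⟨M, fun j x hx w hw =>
    (le_abs_self _).trans ((hB j x hx w hw).trans (hM ⟨j, rfl⟩))⟩

theorem continuousWithinAt_toFun_left (L : G.Lagrangian) {j : E} {x : ℝ}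
    (hx : x ∈ Icc 0 (G.len j)) (w : ℝ) :
    ContinuousWithinAt (fun y => L.toFun j y w) (Icc 0 (G.len j)) x :=
  (L.continuousOn_toFun j (x, w) ⟨hx, mem_univ _⟩).comp
    (f := fun y => (y, w)) (by fun_prop) fun _ hy => ⟨hy, mem_univ _⟩

/-- The superlinear growth is locally uniform in the position: once the growth from `0` to `± R` is
steep enough at one point, it is so at the nearby points, and convexity extends it to all larger
velocities. -/
theorem exists_nhdsWithin_mul_abs_sub_le (L : G.Lagrangian) (j : E) (M : ℝ) {x₀ : ℝ}
    (hx₀ : x₀ ∈ Icc 0 (G.len j)) :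
    ∃ C, ∀ᶠ x in 𝓝[Icc 0 (G.len j)] x₀, ∀ v, M * |v| - C ≤ L.toFun j x v := by
  have hev := (L.superlinear j x₀ hx₀).eventually (eventually_gt_atTop (M + |L.toFun j x₀ 0|))
  rw [← Metric.cobounded_eq_cocompact, (hasBasis_cobounded_norm (E := ℝ)).eventually_iff] at hev
  obtain ⟨R₀, -, hR₀⟩ := hev
  set R := max R₀ 1 with hR
  have hR1 : 1 ≤ R := le_max_right _ _
  have hgrow : ∀ s, |s| = R → L.toFun j x₀ 0 + M * R < L.toFun j x₀ s := by
    intro s hs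
    have h1 := hR₀ (x := s) (by
      show R₀ ≤ ‖s‖
      rw [Real.norm_eq_abs, hs]; exact le_max_left _ _)
    rw [hs, lt_div_iff₀ (by linarith)] at h1
    have h2 : L.toFun j x₀ 0 ≤ |L.toFun j x₀ 0| * R :=
      (le_abs_self _).trans (le_mul_of_one_le_right (abs_nonneg _) hR1)
    linarith
  obtain ⟨B, hB⟩ := L.exists_forall_abs_le j R
  have hnear : ∀ s, |s| = R → ∀ᶠ x in 𝓝[Icc 0 (G.len j)] x₀,
      L.toFun j x 0 + M * R < L.toFun j x s := fun s hs =>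
    ((L.continuousWithinAt_toFun_left hx₀ 0).add continuousWithinAt_const).eventually_lt
      (L.continuousWithinAt_toFun_left hx₀ s) (hgrow s hs)
  -- Here `B` bounds `|L|` for `|v| ≤ R`, which also covers these small velocities.
  have hRabs : |R| = R := abs_of_pos (by linarith)
  refine ⟨B + |M| * R, ?_⟩
  filter_upwards [hnear R hRabs, hnear (-R) (by rw [abs_neg, hRabs]), self_mem_nhdsWithin]
    with x h1 h2 hx v
  have hM0 : 0 ≤ |M| * R := by positivity
  rcases le_or_gt |v| R with hv | hv
  · have h3 := neg_le_of_abs_le (hB x hx v hv)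
    have h4 : M * |v| ≤ |M| * R :=
      (mul_le_mul_of_nonneg_right (le_abs_self M) (abs_nonneg v)).trans
        (mul_le_mul_of_nonneg_left hv (abs_nonneg M))
    linarith
  · have h3 := neg_le_of_abs_le (hB x hx 0 (by simp; linarith))
    have hconv := (L.strictConvexOn j x hx).convexOn
    have ht : 1 ≤ |v| / R := (one_le_div (by linarith)).2 hv.le
    have hcancel : |v| / R * (M * R) = M * |v| := by field_simp
    rcases le_total 0 v with hv0 | hv0
    · have h4 := hconv.add_mul_le_of_one_le ht h1.le
      have h5 : |v| / R * R = v := by rw [abs_of_nonneg hv0]; field_simp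
      rw [hcancel, h5] at h4
      linarith
    · have h4 := hconv.add_mul_le_of_one_le ht h2.le
      have h5 : |v| / R * (-R) = v := by rw [abs_of_nonpos hv0]; field_simp
      rw [hcancel, h5] at h4
      linarith

theorem exists_forall_mul_abs_sub_le_edge (L : G.Lagrangian) (j : E) (M : ℝ) :
    ∃ C, ∀ x ∈ Icc 0 (G.len j), ∀ v, M * |v| - C ≤ L.toFun j x v := by
  refine isCompact_Icc.induction_on (p := fun S => ∃ C, ∀ x ∈ S, ∀ v, M * |v| - C ≤ L.toFun j x v)
    ⟨0, by simp⟩ (fun s t hst ⟨C, hC⟩ => ⟨C, fun x hx => hC x (hst hx)⟩) ?_ ?_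
  · rintro s t ⟨C, hC⟩ ⟨D, hD⟩
    refine ⟨max C D, fun x hx v => ?_⟩
    rcases hx with hx | hx
    · linarith [hC x hx v, le_max_left C D]
    · linarith [hD x hx v, le_max_right C D]
  · intro x hx
    obtain ⟨C, hC⟩ := L.exists_nhdsWithin_mul_abs_sub_le j M hx
    exact ⟨_, hC, C, fun y hy => hy⟩

theorem exists_forall_mul_abs_sub_le [Finite E] (L : G.Lagrangian) (M : ℝ) :
    ∃ C, ∀ j, ∀ x ∈ Icc 0 (G.len j), ∀ v, M * |v| - C ≤ L.toFun j x v := by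
  choose C hC using fun j => L.exists_forall_mul_abs_sub_le_edge j M
  obtain ⟨D, hD⟩ := (finite_range C).bddAbove
  exact ⟨D, fun j x hx v => by linarith [hC j x hx v, hD ⟨j, rfl⟩]⟩

/-- The strict form of the inequality `p * w ≤ L + c`, uniformly in the velocity `w`, is stable
under small changes of the position and of the slope `p`. -/
theorem exists_pos_forall_mul_le_of_lt (L : G.Lagrangian) {j : E} {x₀ p₀ c₀ c : ℝ}
    (hx₀ : x₀ ∈ Icc 0 (G.len j)) (h : ∀ w, p₀ * w ≤ L.toFun j x₀ w + c₀) (hc : c₀ < c) :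
    ∃ η > 0, ∀ x ∈ Icc 0 (G.len j), |x - x₀| < η → ∀ p, |p - p₀| < η →
      ∀ w, p * w ≤ L.toFun j x w + c := by
  obtain ⟨C, hC⟩ := L.exists_forall_mul_abs_sub_le_edge j (|p₀| + 2)
  have hcompact : ∀ᶠ q : ℝ × ℝ in 𝓝 (x₀, p₀), ∀ w ∈ Icc (-|C - c|) |C - c|,
      q.1 ∈ Icc 0 (G.len j) → q.2 * w ≤ L.toFun j q.1 w + c := by
    refine isCompact_Icc.eventually_forall_of_forall_eventually
      (P := fun (q : ℝ × ℝ) w => q.1 ∈ Icc 0 (G.len j) → q.2 * w ≤ L.toFun j q.1 w + c)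
      fun w _ => ?_
    have hcont : ContinuousWithinAt (fun z : (ℝ × ℝ) × ℝ => L.toFun j z.1.1 z.2 + c)
        {z | z.1.1 ∈ Icc 0 (G.len j)} ((x₀, p₀), w) := by
      refine ContinuousWithinAt.add ?_ continuousWithinAt_const
      exact ContinuousWithinAt.comp (x := ((x₀, p₀), w))
        (f := fun z : (ℝ × ℝ) × ℝ => (z.1.1, z.2)) (g := fun q : ℝ × ℝ => L.toFun j q.1 q.2)
        (L.continuousOn_toFun j (x₀, w) ⟨hx₀, mem_univ _⟩)
        (Continuous.continuousWithinAt (by fun_prop)) fun z hz => ⟨hz, mem_univ _⟩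
    have hlt := (show ContinuousWithinAt (fun z : (ℝ × ℝ) × ℝ => z.1.2 * z.2)
        {z | z.1.1 ∈ Icc 0 (G.len j)} ((x₀, p₀), w) by fun_prop).eventually_lt hcont
      (by linarith [h w])
    exact (eventually_nhdsWithin_iff.1 hlt).mono fun z hz hz' => (hz hz').le
  obtain ⟨η, hη, hball⟩ := Metric.eventually_nhds_iff.1 hcompact
  refine ⟨min η 1, lt_min hη one_pos, fun x hx hxx p hp w => ?_⟩
  rcases le_or_gt |w| |C - c| with hw | hw
  · refine hball (y := (x, p)) ?_ w (abs_le.1 hw) hx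
    rw [Prod.dist_eq, max_lt_iff, Real.dist_eq, Real.dist_eq]
    exact ⟨hxx.trans_le (min_le_left _ _), hp.trans_le (min_le_left _ _)⟩
  · have h1 := hC x hx w
    have h2 : |p| ≤ |p₀| + 1 := by
      have := abs_sub_abs_le_abs_sub p p₀
      linarith [hp.trans_le (min_le_right _ _)]
    have h3 : p * w ≤ (|p₀| + 1) * |w| :=
      (le_abs_self _).trans (by rw [abs_mul]; gcongr)
    linarith [le_abs_self (C - c)]

theorem bddAbove_hamiltonian_set (L : G.Lagrangian) {j : E} {x : ℝ} (hx : x ∈ Icc 0 (G.len j))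
    (p : ℝ) : BddAbove {r | ∃ z : ℝ, (x = 0 → 0 ≤ z) ∧ (x = G.len j → z ≤ 0) ∧
      r = -p * z - L.toFun j x (-z)} := by
  obtain ⟨C, hC⟩ := L.exists_forall_mul_abs_sub_le_edge j |p|
  refine ⟨C, ?_⟩
  rintro _ ⟨z, -, -, rfl⟩
  have h1 := hC x hx (-z)
  have h2 := le_abs_self (p * -z)
  rw [abs_mul] at h2
  linarith

theorem mul_sub_le_hamiltonian (L : G.Lagrangian) {j : E} {x : ℝ} (hx : x ∈ Icc 0 (G.len j))
    (p : ℝ) {w : ℝ} (h₀ : x = 0 → w ≤ 0) (h₁ : x = G.len j → 0 ≤ w) :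
    p * w - L.toFun j x w ≤ L.hamiltonian j x p :=
  le_csSup (L.bddAbove_hamiltonian_set hx p)
    ⟨-w, fun h => neg_nonneg.2 (h₀ h), fun h => neg_nonpos.2 (h₁ h), by simp⟩

theorem hamiltonian_le (L : G.Lagrangian) {j : E} {x p B : ℝ}
    (h : ∀ w, (x = 0 → w ≤ 0) → (x = G.len j → 0 ≤ w) → p * w - L.toFun j x w ≤ B) :
    L.hamiltonian j x p ≤ B := by
  refine csSup_le ⟨_, 0, fun _ => le_rfl, fun _ => le_rfl, rfl⟩ ?_
  rintro _ ⟨z, h₀, h₁, rfl⟩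
  have := h (-z) (fun h => neg_nonpos.2 (h₀ h)) (fun h => neg_nonneg.2 (h₁ h))
  linarith

theorem hamiltonian_le_hamiltonianAt [Finite E] (L : G.Lagrangian) (φ : G.Pt → ℝ → ℝ) {j : E}
    {x : ℝ} (hx : x ∈ Icc 0 (G.len j)) (t : ℝ) :
    L.hamiltonian j x (edgeDeriv φ j x t) ≤ L.hamiltonianAt φ (G.pt j x) t := by
  refine le_csSup (Set.Finite.bddAbove ?_) ⟨j, x, hx, rfl, rfl⟩
  -- A point has at most the coordinates `0`, `len k` and its own coordinate on an edge `k`.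
  refine (finite_iUnion fun k : E => (toFinite {0, G.len k, (G.pt j x).coord}).image
    fun y => L.hamiltonian k y (edgeDeriv φ k y t)).subset ?_
  rintro _ ⟨k, y, hy, hP, rfl⟩
  refine mem_iUnion.2 ⟨k, y, ?_, rfl⟩
  rw [← hP]
  rcases hy.1.eq_or_lt with rfl | h
  · simp
  · rcases hy.2.eq_or_lt with rfl | h'
    · simp
    · rw [pt_inner _ _ _ ⟨h, h'⟩]
      simp [Pt.coord]

end Lagrangian

end MetricGraph

/-! ### Curves with finite action -/

namespace MetricGraph

variable {V E : Type*} {G : MetricGraph V E}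

namespace Lagrangian

/-- `γ` is an absolutely continuous curve of finite action on `[a, b]`. -/
structure IsFiniteCurve (L : G.Lagrangian) (γ : ℝ → G.Pt) (a b : ℝ) : Prop where
  absCont : AbsolutelyContinuousOnInterval γ a b
  integrable : IntervalIntegrable (L.along γ) volume a b

variable {L : G.Lagrangian}

theorem IsFiniteCurve.mono {γ : ℝ → G.Pt} {a b c d : ℝ} (h : L.IsFiniteCurve γ a b)
    (hsub : uIcc c d ⊆ uIcc a b) : L.IsFiniteCurve γ c d :=
  ⟨h.absCont.mono hsub, h.integrable.mono_set hsub⟩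

theorem along_congr {γ γ' : ℝ → G.Pt} {τ : ℝ} (h : γ =ᶠ[𝓝 τ] γ') :
    L.along γ τ = L.along γ' τ := by
  unfold along
  have h1 : (fun s => (γ s).coord) =ᶠ[𝓝 τ] fun s => (γ' s).coord := h.fun_comp Pt.coord
  rw [h.self_of_nhds, h1.deriv_eq]

theorem ae_along_eq_of_eqOn {γ γ' : ℝ → G.Pt} {a b : ℝ} (hab : a ≤ b) (h : EqOn γ γ' (Icc a b)) :
    ∀ᵐ τ ∂volume.restrict (uIoc a b), L.along γ τ = L.along γ' τ := by
  rw [uIoc_of_le hab, Measure.restrict_congr_set Ioo_ae_eq_Ioc.symm]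
  refine (ae_restrict_iff' measurableSet_Ioo).2 (Eventually.of_forall fun τ hτ => ?_)
  refine along_congr ?_
  filter_upwards [Icc_mem_nhds hτ.1 hτ.2] with s hs using h hs

theorem IsFiniteCurve.congr {γ γ' : ℝ → G.Pt} {a b : ℝ} (hab : a ≤ b)
    (hγ : L.IsFiniteCurve γ a b) (h : EqOn γ γ' (Icc a b)) : L.IsFiniteCurve γ' a b :=
  ⟨hγ.absCont.congr (by rwa [uIcc_of_le hab]),
    hγ.integrable.congr_ae (ae_along_eq_of_eqOn hab h)⟩

theorem integral_along_congr {γ γ' : ℝ → G.Pt} {a b : ℝ} (hab : a ≤ b)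
    (h : EqOn γ γ' (Icc a b)) : ∫ t in a..b, L.along γ t = ∫ t in a..b, L.along γ' t :=
  intervalIntegral.integral_congr_ae_restrict (ae_along_eq_of_eqOn hab h)

/-- Concatenation of curves of finite action. -/
theorem IsFiniteCurve.exists_concat {γ₁ γ₂ : ℝ → G.Pt} {a b c : ℝ} (hab : a ≤ b) (hbc : b ≤ c)
    (h₁ : L.IsFiniteCurve γ₁ a b) (h₂ : L.IsFiniteCurve γ₂ b c) (h : γ₁ b = γ₂ b) :
    ∃ γ, L.IsFiniteCurve γ a c ∧ γ a = γ₁ a ∧ γ c = γ₂ c ∧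
      ∫ t in a..c, L.along γ t = (∫ t in a..b, L.along γ₁ t) + ∫ t in b..c, L.along γ₂ t := by
  let γ : ℝ → G.Pt := fun τ => if τ ≤ b then γ₁ τ else γ₂ τ
  have e₁ : EqOn γ₁ γ (Icc a b) := fun τ hτ => by simp [γ, hτ.2]
  have e₂ : EqOn γ₂ γ (Icc b c) := fun τ hτ => by
    rcases hτ.1.eq_or_lt with rfl | hlt
    · simp [γ, h]
    · simp [γ, not_le.2 hlt]
  have c₁ := h₁.congr hab e₁
  have c₂ := h₂.congr hbc e₂
  refine ⟨γ, ⟨c₁.absCont.trans hab hbc c₂.absCont, c₁.integrable.trans c₂.integrable⟩,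
    (e₁ ⟨le_rfl, hab⟩).symm, (e₂ ⟨hbc, le_rfl⟩).symm, ?_⟩
  rw [integral_along_congr hab e₁, integral_along_congr hbc e₂,
    intervalIntegral.integral_add_adjacent_intervals c₁.integrable c₂.integrable]

theorem along_comp_add_right (γ : ℝ → G.Pt) (d τ : ℝ) :
    L.along (fun s => γ (s + d)) τ = L.along γ (τ + d) := by
  unfold along
  rw [deriv_comp_add_const (fun s => (γ s).coord) d τ]

theorem IsFiniteCurve.comp_add_right {γ : ℝ → G.Pt} {a b d : ℝ}
    (h : L.IsFiniteCurve γ (a + d) (b + d)) : L.IsFiniteCurve (fun s => γ (s + d)) a b := by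
  refine ⟨h.absCont.comp_add_right d, ?_⟩
  rw [funext (along_comp_add_right (L := L) γ d)]
  simpa using h.integrable.comp_add_right d

theorem integral_along_comp_add_right (γ : ℝ → G.Pt) (a b d : ℝ) :
    ∫ t in a..b, L.along (fun s => γ (s + d)) t = ∫ t in (a + d)..(b + d), L.along γ t := by
  simp only [along_comp_add_right]
  exact intervalIntegral.integral_comp_add_right (L.along γ) d

theorem add_mul_sub_mem_Icc {l x w s t : ℝ} (hx : x ∈ Icc 0 l)
    (hs : x + w * (s - t) ∈ Icc 0 l) {τ : ℝ} (hτ : τ ∈ Icc s t) : x + w * (τ - t) ∈ Icc 0 l := by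
  obtain ⟨h1, h2⟩ := hx
  obtain ⟨h3, h4⟩ := hs
  obtain ⟨h5, h6⟩ := hτ
  rcases le_total 0 w with hw | hw
  · exact ⟨by nlinarith, by nlinarith⟩
  · exact ⟨by nlinarith, by nlinarith⟩

/-- The integrand of the action of a curve that runs along an edge at constant velocity `w`. A curve
at an end of the edge at an intermediate time has velocity `0`, where `L` has the value `rest`. -/
theorem along_segment {j : E} {x w s t : ℝ} (hx : x ∈ Icc 0 (G.len j))
    (hs : x + w * (s - t) ∈ Icc 0 (G.len j)) {τ : ℝ} (hτ : τ ∈ Ioo s t) :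
    L.along (fun r => G.pt j (x + w * (r - t))) τ = L.toFun j (x + w * (τ - t)) w := by
  have hmem := add_mul_sub_mem_Icc hx hs (Ioo_subset_Icc_self hτ)
  have hend : x + w * (τ - t) = 0 ∨ x + w * (τ - t) = G.len j → w = 0 := by
    intro h
    by_contra hw
    obtain ⟨h1, h2⟩ := hx
    obtain ⟨h3, h4⟩ := hs
    obtain ⟨h5, h6⟩ := hτ
    rcases lt_or_gt_of_ne hw with hw | hw <;> rcases h with h | h <;> nlinarith
  by_cases hin : x + w * (τ - t) ∈ Ioo 0 (G.len j)
  · rw [along_of_eq_inner (γ := fun r => G.pt j (x + w * (r - t))) (G.pt_inner j _ hin)]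
    congr 1
    have hc : ContinuousAt (fun r : ℝ => x + w * (r - t)) τ := by fun_prop
    have hev : (fun r => (G.pt j (x + w * (r - t))).coord) =ᶠ[𝓝 τ] fun r => x + w * (r - t) := by
      filter_upwards [hc.eventually (isOpen_Ioo.mem_nhds hin)] with r hr
      rw [pt_inner _ _ _ hr]; rfl
    rw [hev.deriv_eq]
    have : HasDerivAt (fun r : ℝ => x + w * (r - t)) (w * 1) τ :=
      (((hasDerivAt_id τ).sub_const t).const_mul w).const_add x
    rw [this.deriv, mul_one]
  · rcases hmem.1.eq_or_lt with h0 | h0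
    · have hw := hend (Or.inl h0.symm)
      rw [along_of_eq_vertex (v := G.src j) (by simp only [← h0, pt_zero]), ← h0, hw, L.rest_src]
    · rcases hmem.2.eq_or_lt with h1 | h1
      · have hw := hend (Or.inr h1)
        rw [along_of_eq_vertex (v := G.tgt j) (by simp only [h1, pt_len]), h1, hw, L.rest_tgt]
      · exact absurd ⟨h0, h1⟩ hin

theorem continuousOn_toFun_segment (L : G.Lagrangian) {j : E} {x w s t : ℝ}
    (hx : x ∈ Icc 0 (G.len j)) (hs : x + w * (s - t) ∈ Icc 0 (G.len j)) :
    ContinuousOn (fun τ => L.toFun j (x + w * (τ - t)) w) (Icc s t) :=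
  (L.continuousOn_toFun j).comp (f := fun τ : ℝ => (x + w * (τ - t), w))
    (Continuous.continuousOn (by fun_prop))
    fun _ hτ => ⟨add_mul_sub_mem_Icc hx hs hτ, mem_univ _⟩

theorem isFiniteCurve_segment (L : G.Lagrangian) {j : E} {x w s t : ℝ} (hst : s ≤ t)
    (hx : x ∈ Icc 0 (G.len j)) (hs : x + w * (s - t) ∈ Icc 0 (G.len j)) :
    L.IsFiniteCurve (fun τ => G.pt j (x + w * (τ - t))) s t ∧
      ∫ τ in s..t, L.along (fun τ => G.pt j (x + w * (τ - t))) τ =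
        ∫ τ in s..t, L.toFun j (x + w * (τ - t)) w := by
  have hae : ∀ᵐ τ ∂volume.restrict (uIoc s t), L.toFun j (x + w * (τ - t)) w =
      L.along (fun τ => G.pt j (x + w * (τ - t))) τ := by
    rw [uIoc_of_le hst, Measure.restrict_congr_set Ioo_ae_eq_Ioc.symm]
    exact (ae_restrict_iff' measurableSet_Ioo).2
      (Eventually.of_forall fun τ hτ => (along_segment hx hs hτ).symm)
  refine ⟨⟨?_, ?_⟩, (intervalIntegral.integral_congr_ae_restrict hae).symm⟩
  · refine LipschitzOnWith.absolutelyContinuousOnInterval (K := |w|.toNNReal) ?_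
    rw [uIcc_of_le hst]
    refine LipschitzOnWith.of_dist_le_mul fun a ha b hb => ?_
    refine (dist_pt_le (add_mul_sub_mem_Icc hx hs ha) (add_mul_sub_mem_Icc hx hs hb)).trans ?_
    rw [Real.dist_eq, abs_sub_comm a b, Real.coe_toNNReal _ (abs_nonneg w), ← abs_mul]
    exact le_of_eq (by congr 1; ring)
  · refine IntervalIntegrable.congr_ae (ContinuousOn.intervalIntegrable ?_) hae
    rw [uIcc_of_le hst]
    exact L.continuousOn_toFun_segment hx hs

/-! ### The value function -/

/-- The values `f (γ 0) + A(γ)` of the curves of finite action with `γ t = x`. -/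
def costs (L : G.Lagrangian) (f : G.Pt → ℝ) (x : G.Pt) (t : ℝ) : Set ℝ :=
  {r | ∃ γ, L.IsFiniteCurve γ 0 t ∧ γ t = x ∧ r = f (γ 0) + ∫ τ in (0 : ℝ)..t, L.along γ τ}

/-- The real-valued form of the Lax-Oleinik semigroup. -/
noncomputable def value (L : G.Lagrangian) (f : G.Pt → ℝ) (x : G.Pt) (t : ℝ) : ℝ :=
  sInf (L.costs f x t)

theorem isFiniteCurve_const [Nonempty E] (L : G.Lagrangian) (x : G.Pt) {s t : ℝ} (hst : s ≤ t) :
    L.IsFiniteCurve (fun _ => x) s t := by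
  obtain ⟨j, y, hy, rfl⟩ := exists_pt_eq x
  simpa using (L.isFiniteCurve_segment (w := 0) hst hy (by simpa using hy)).1

theorem costs_nonempty [Nonempty E] (L : G.Lagrangian) (f : G.Pt → ℝ) (x : G.Pt) {t : ℝ}
    (ht : 0 ≤ t) : (L.costs f x t).Nonempty :=
  ⟨_, fun _ => x, L.isFiniteCurve_const x ht, rfl, rfl⟩

theorem exists_curve_lt_of_value_lt [Nonempty E] {f : G.Pt → ℝ} {x : G.Pt} {t r : ℝ}
    (ht : 0 ≤ t) (h : L.value f x t < r) : ∃ γ, L.IsFiniteCurve γ 0 t ∧ γ t = x ∧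
      f (γ 0) + ∫ τ in (0 : ℝ)..t, L.along γ τ < r := by
  obtain ⟨_, ⟨γ, h1, h2, rfl⟩, h4⟩ := exists_lt_of_csInf_lt (L.costs_nonempty f x ht) h
  exact ⟨γ, h1, h2, h4⟩

theorem value_zero [Nonempty E] (L : G.Lagrangian) {f : G.Pt → ℝ} (x : G.Pt) :
    L.value f x 0 = f x := by
  have : L.costs f x 0 = {f x} := by
    ext r
    refine ⟨fun ⟨γ, _, h1, h2⟩ => ?_, fun h => ?_⟩
    · rw [h2, h1]; simp
    · exact ⟨fun _ => x, L.isFiniteCurve_const x le_rfl, rfl, by simpa using h⟩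
  rw [value, this, csInf_singleton]

theorem exists_sub_le_add_mul_dist [Finite E] [Nonempty E] {f : G.Pt → ℝ}
    (hf : Continuous f) {ε : ℝ} (hε : 0 < ε) :
    ∃ M, 0 ≤ M ∧ ∀ x y, f x - f y ≤ ε + M * dist x y := by
  obtain ⟨ρ, hρ, h⟩ := Metric.uniformContinuous_iff.1
    (CompactSpace.uniformContinuous_of_continuous hf) ε hε
  obtain ⟨B, hB⟩ := (isCompact_range hf).isBounded.exists_norm_le
  have hB' : ∀ x, |f x| ≤ B := fun x => hB _ ⟨x, rfl⟩
  refine ⟨2 * |B| / ρ, by positivity, fun x y => ?_⟩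
  rcases lt_or_ge (dist x y) ρ with hxy | hxy
  · have h1 := h hxy
    rw [Real.dist_eq] at h1
    have : 0 ≤ 2 * |B| / ρ * dist x y := by positivity
    linarith [le_abs_self (f x - f y)]
  · have h1 : 2 * |B| ≤ 2 * |B| / ρ * dist x y := by
      rw [div_mul_eq_mul_div, le_div_iff₀ hρ]
      gcongr
    linarith [le_abs_self (f x), neg_abs_le (f y), hB' x, hB' y, le_abs_self B]

variable [Finite V] [Finite E] [Nonempty E]

theorem IsFiniteCurve.mul_dist_le {γ : ℝ → G.Pt} {a b : ℝ} (hγ : L.IsFiniteCurve γ a b)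
    (hab : a ≤ b) {M C : ℝ} (hM : 0 ≤ M)
    (hC : ∀ j, ∀ x ∈ Icc 0 (G.len j), ∀ v, M * |v| - C ≤ L.toFun j x v) :
    M * dist (γ a) (γ b) ≤ (∫ t in a..b, L.along γ t) + C * (b - a) :=
  mul_dist_le_integral_along hab hγ.absCont hγ.integrable hM hC

theorem exists_forall_le_costs (L : G.Lagrangian) {f : G.Pt → ℝ} (hf : Continuous f) :
    ∃ m C : ℝ, ∀ x t, 0 ≤ t → ∀ r ∈ L.costs f x t, m - C * t ≤ r := by
  obtain ⟨m, hm⟩ := (isCompact_range hf).bddBelow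
  obtain ⟨C, hC⟩ := L.exists_forall_mul_abs_sub_le 0
  refine ⟨m, C, fun x t ht r => ?_⟩
  rintro ⟨γ, hγ, -, rfl⟩
  have := hγ.mul_dist_le ht le_rfl hC
  linarith [hm ⟨γ 0, rfl⟩]

theorem bddBelow_costs (L : G.Lagrangian) {f : G.Pt → ℝ} (hf : Continuous f) (x : G.Pt) {t : ℝ}
    (ht : 0 ≤ t) : BddBelow (L.costs f x t) := by
  obtain ⟨m, C, h⟩ := L.exists_forall_le_costs hf
  exact ⟨_, h x t ht⟩

theorem exists_forall_le_value (L : G.Lagrangian) {f : G.Pt → ℝ} (hf : Continuous f) :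
    ∃ m C : ℝ, ∀ x t, 0 ≤ t → m - C * t ≤ L.value f x t := by
  obtain ⟨m, C, h⟩ := L.exists_forall_le_costs hf
  exact ⟨m, C, fun x t ht => le_csInf (L.costs_nonempty f x ht) (h x t ht)⟩

theorem IsFiniteCurve.value_le {γ : ℝ → G.Pt} {t : ℝ} (hγ : L.IsFiniteCurve γ 0 t) (ht : 0 ≤ t)
    {f : G.Pt → ℝ} (hf : Continuous f) :
    L.value f (γ t) t ≤ f (γ 0) + ∫ τ in (0 : ℝ)..t, L.along γ τ :=
  csInf_le (L.bddBelow_costs hf _ ht) ⟨γ, hγ, rfl, rfl⟩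

/-- The dynamic programming inequality. -/
theorem IsFiniteCurve.value_le_value_add {γ : ℝ → G.Pt} {s t : ℝ} (hγ : L.IsFiniteCurve γ s t)
    (hs : 0 ≤ s) (hst : s ≤ t) {f : G.Pt → ℝ} (hf : Continuous f) :
    L.value f (γ t) t ≤ L.value f (γ s) s + ∫ τ in s..t, L.along γ τ := by
  refine le_of_forall_pos_lt_add fun ε hε => ?_
  obtain ⟨γ', hγ', h1, h2⟩ := exists_curve_lt_of_value_lt hs
    (lt_add_of_pos_right (L.value f (γ s) s) hε)
  obtain ⟨β, hβ, h3, h4, h5⟩ := hγ'.exists_concat hs hst hγ h1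
  have h6 := hβ.value_le (hs.trans hst) hf
  rw [h3, h4, h5] at h6
  linarith

theorem coe_value_eq_laxOleinik (L : G.Lagrangian) {f : G.Pt → ℝ} (hf : Continuous f) (x : G.Pt)
    {t : ℝ} (ht : 0 ≤ t) : (L.value f x t : EReal) = L.laxOleinik t f x := by
  apply le_antisymm
  · refine le_iInf fun y => ?_
    have : ((L.value f x t - f y : ℝ) : EReal) ≤ L.h t y x := by
      refine le_iInf₂ fun γ hγ => ?_
      obtain ⟨hac, rfl, rfl⟩ := hγ
      unfold action
      split_ifs with hint
      · have := IsFiniteCurve.value_le ⟨hac, hint⟩ ht hf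
        exact EReal.coe_le_coe_iff.2 (by linarith)
      · exact le_top
    calc (L.value f x t : EReal) = (f y : EReal) + ((L.value f x t - f y : ℝ) : EReal) := by
          rw [← EReal.coe_add]; congr 1; ring
      _ ≤ _ := by gcongr
  · refine EReal.le_of_forall_lt_iff_le.1 fun r hr => ?_
    obtain ⟨γ, hγ, h1, h2⟩ := exists_curve_lt_of_value_lt ht (EReal.coe_lt_coe_iff.1 hr)
    refine (iInf_le _ (γ 0)).trans ?_
    have h3 : L.h t (γ 0) x ≤ L.action γ 0 t := iInf₂_le γ ⟨hγ.absCont, rfl, h1⟩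
    rw [action, if_pos hγ.integrable] at h3
    refine (add_le_add_right h3 _).trans ?_
    rw [← EReal.coe_add]
    exact EReal.coe_le_coe_iff.2 h2.le

/-! ### Continuity of the value function -/

/-- Moving along an edge at speed at most one costs at most a constant times the time. -/
theorem exists_value_le_value_add_mul (L : G.Lagrangian) {f : G.Pt → ℝ} (hf : Continuous f) :
    ∃ C, 0 ≤ C ∧ ∀ j, ∀ x ∈ Icc 0 (G.len j), ∀ y ∈ Icc 0 (G.len j), ∀ s t, 0 ≤ s → s < t →
      |y - x| ≤ t - s → L.value f (G.pt j y) t ≤ L.value f (G.pt j x) s + C * (t - s) := by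
  obtain ⟨C, hC⟩ := L.exists_forall_le_of_abs_le 1
  refine ⟨max C 0, le_max_right _ _, fun j x hx y hy s t hs hst hxy => ?_⟩
  have hts : 0 < t - s := sub_pos.2 hst
  set w := (y - x) / (t - s) with hw
  have hw1 : |w| ≤ 1 := by
    rw [hw, abs_div, abs_of_pos hts]
    exact (div_le_one hts).2 hxy
  have hstart : y + w * (s - t) = x := by
    rw [hw]; field_simp; ring
  obtain ⟨h1, h2⟩ := L.isFiniteCurve_segment (w := w) hst.le hy (by rwa [hstart])
  have h3 := h1.value_le_value_add hs hst.le hf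
  rw [h2] at h3
  simp only [hstart, sub_self, mul_zero, add_zero] at h3
  refine h3.trans (add_le_add_right ?_ _)
  calc ∫ τ in s..t, L.toFun j (y + w * (τ - t)) w ≤ ∫ τ in s..t, max C 0 := by
        refine intervalIntegral.integral_mono_on hst.le ?_ (by simp) fun τ hτ => ?_
        · refine ContinuousOn.intervalIntegrable ?_
          rw [uIcc_of_le hst.le]
          exact L.continuousOn_toFun_segment hy (by rwa [hstart])
        · exact (hC j _ (add_mul_sub_mem_Icc hy (by rwa [hstart]) hτ) w hw1).trans (le_max_left _ _)
    _ = max C 0 * (t - s) := by simp [mul_comm]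

/-- The value function does not decrease fast in time. By superlinearity this holds near the time
`0`, where a curve pays more for its displacement than the oscillation of `f` along it; dropping
the initial piece of a nearly optimal curve transfers the estimate to later times. -/
theorem exists_pos_value_le_value_add (L : G.Lagrangian) {f : G.Pt → ℝ} (hf : Continuous f)
    {ε : ℝ} (hε : 0 < ε) :
    ∃ δ > 0, ∀ s t, 0 ≤ s → s ≤ t → t - s ≤ δ → ∀ x, L.value f x s ≤ L.value f x t + ε := by
  obtain ⟨M, hM, hfM⟩ := exists_sub_le_add_mul_dist hf (show 0 < ε / 3 by positivity)
  obtain ⟨C, hC⟩ := L.exists_forall_mul_abs_sub_le M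
  refine ⟨ε / 3 / (|C| + 1), by positivity, fun s t hs hst hδ x => ?_⟩
  obtain ⟨γ, hγ, h1, h2⟩ := exists_curve_lt_of_value_lt (hs.trans hst)
    (lt_add_of_pos_right (L.value f x t) (show 0 < ε / 3 by positivity))
  have ht : 0 ≤ t := hs.trans hst
  have hd : t - s ∈ uIcc 0 t := by rw [uIcc_of_le ht]; constructor <;> linarith
  have hγ₁ : L.IsFiniteCurve γ 0 (t - s) := hγ.mono (uIcc_subset_uIcc_left hd)
  have hγ₂ : L.IsFiniteCurve γ (t - s) t := hγ.mono (uIcc_subset_uIcc_right hd)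
  have h3 := hγ₁.mul_dist_le (sub_nonneg.2 hst) hM hC
  have h4 : L.IsFiniteCurve (fun τ => γ (τ + (t - s))) 0 s :=
    IsFiniteCurve.comp_add_right (by simpa using hγ₂)
  have h5 := h4.value_le hs hf
  rw [integral_along_comp_add_right] at h5
  simp only [zero_add, add_sub_cancel, h1] at h5
  have h6 := intervalIntegral.integral_add_adjacent_intervals hγ₁.integrable hγ₂.integrable
  have h7 := hfM (γ (t - s)) (γ 0)
  rw [dist_comm] at h7
  have h8 : C * (t - s - 0) ≤ ε / 3 := by
    have : (t - s) * (|C| + 1) ≤ ε / 3 := (le_div_iff₀ (by positivity)).1 hδ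
    nlinarith [le_abs_self C]
  linarith

theorem exists_pos_abs_value_sub_value_le (L : G.Lagrangian) {f : G.Pt → ℝ} (hf : Continuous f)
    {ε : ℝ} (hε : 0 < ε) :
    ∃ δ > 0, ∀ s t, 0 ≤ s → 0 ≤ t → |t - s| ≤ δ → ∀ x, |L.value f x t - L.value f x s| ≤ ε := by
  obtain ⟨δ, hδ, h⟩ := L.exists_pos_value_le_value_add hf hε
  obtain ⟨C, hC0, hC⟩ := L.exists_value_le_value_add_mul hf
  have key : ∀ s t, 0 ≤ s → s ≤ t → t - s ≤ min δ (ε / (C + 1)) →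
      ∀ x, |L.value f x t - L.value f x s| ≤ ε := by
    intro s t hs hst hle x
    have h1 := h s t hs hst (hle.trans (min_le_left _ _)) x
    rcases hst.eq_or_lt with rfl | hlt
    · simpa using hε.le
    · obtain ⟨j, y, hy, rfl⟩ := exists_pt_eq x
      have h2 := hC j y hy y hy s t hs hlt (by simpa using hst)
      have h3 : (t - s) * (C + 1) ≤ ε :=
        (le_div_iff₀ (by positivity)).1 (hle.trans (min_le_right _ _))
      rw [abs_le]
      constructor <;> nlinarith
  refine ⟨min δ (ε / (C + 1)), by positivity, fun s t hs ht hst x => ?_⟩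
  rcases le_total s t with h' | h'
  · exact key s t hs h' ((le_abs_self _).trans hst) x
  · rw [abs_sub_comm]
    exact key t s ht h' ((le_abs_self _).trans (by rwa [abs_sub_comm])) x

theorem continuous_value (L : G.Lagrangian) {f : G.Pt → ℝ} (hf : Continuous f) {t : ℝ}
    (ht : 0 ≤ t) : Continuous fun x => L.value f x t := by
  rcases ht.eq_or_lt with rfl | ht
  · simpa only [value_zero] using hf
  rw [Metric.continuous_iff']
  intro x ε hε
  obtain ⟨δ, hδ, h⟩ := L.exists_pos_value_le_value_add hf (show 0 < ε / 3 by positivity)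
  obtain ⟨C, hC0, hC⟩ := L.exists_value_le_value_add_mul hf
  obtain ⟨r, hr, hnear⟩ := exists_pt_eq_pt_eq_of_dist_lt x
  set d := min δ (min t (ε / 3 / (C + 1))) with hd
  have hd0 : 0 < d := by positivity
  have hd1 : d ≤ δ := min_le_left _ _
  have hd2 : d ≤ t := (min_le_right _ _).trans (min_le_left _ _)
  have hd3 : C * d ≤ ε / 3 := by
    have := (le_div_iff₀ (by positivity)).1
      ((min_le_right _ _).trans (min_le_right _ _) : d ≤ ε / 3 / (C + 1))
    nlinarith
  filter_upwards [Metric.ball_mem_nhds x (lt_min hr hd0)] with y hy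
  rw [Metric.mem_ball, lt_min_iff] at hy
  obtain ⟨j, a, ha, b, hb, rfl, rfl, hab⟩ := hnear y hy.1
  have hab' : |b - a| ≤ t - (t - d) := by linarith [hy.2]
  have h1 := hC j a ha b hb (t - d) t (by linarith) (by linarith) hab'
  have h2 := hC j b hb a ha (t - d) t (by linarith) (by linarith) (by rwa [abs_sub_comm])
  have h3 := h (t - d) t (by linarith) (by linarith) (by linarith) (G.pt j a)
  have h4 := h (t - d) t (by linarith) (by linarith) (by linarith) (G.pt j b)
  rw [sub_sub_cancel] at h1 h2
  rw [Real.dist_eq, abs_lt]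
  constructor <;> linarith

theorem continuousOn_value (L : G.Lagrangian) {f : G.Pt → ℝ} (hf : Continuous f) :
    ContinuousOn (fun q : G.Pt × ℝ => L.value f q.1 q.2) (univ ×ˢ Ici 0) := by
  rintro ⟨x, t⟩ ⟨-, ht : 0 ≤ t⟩
  rw [Metric.continuousWithinAt_iff']
  intro ε hε
  obtain ⟨δ, hδ, h⟩ := L.exists_pos_abs_value_sub_value_le hf (half_pos hε)
  have h1 : ∀ᶠ q : G.Pt × ℝ in 𝓝 (x, t), dist (L.value f q.1 t) (L.value f x t) < ε / 2 :=
    Metric.tendsto_nhds.1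
      (((L.continuous_value hf ht).comp continuous_fst).tendsto (x, t)) _ (half_pos hε)
  have h2 : ∀ᶠ q : G.Pt × ℝ in 𝓝 (x, t), dist q.2 t < δ :=
    Metric.tendsto_nhds.1 (continuous_snd.tendsto (x, t)) _ hδ
  filter_upwards [nhdsWithin_le_nhds h1, nhdsWithin_le_nhds h2, self_mem_nhdsWithin]
    with q hq1 hq2 hq3
  have h3 := h t q.2 ht hq3.2 (by rw [← Real.dist_eq]; exact hq2.le) q.1
  rw [← Real.dist_eq] at h3
  exact (dist_triangle _ _ _).trans_lt (by linarith)

end Lagrangian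

end MetricGraph

/-! ### The subsolution property -/

namespace MetricGraph

variable {V E : Type*} {G : MetricGraph V E}

/-- The first order expansion, on one edge through `P`, of a function that is `C¹` near `(P, t)`. -/
theorem C1Near.exists_pos_abs_sub_le {φ : G.Pt → ℝ → ℝ} {j : E} {x t : ℝ}
    (hφ : C1Near φ (G.pt j x) t) (hx : x ∈ Icc 0 (G.len j)) {ε : ℝ} (hε : 0 < ε) :
    ∃ ρ > 0, ∀ y ∈ Icc 0 (G.len j), |y - x| < ρ → ∀ τ, |τ - t| < ρ →
      |φ (G.pt j y) τ - φ (G.pt j x) t -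
        (edgeDeriv φ j x t * (y - x) + deriv (φ (G.pt j x)) t * (τ - t))| ≤
          ε * (|y - x| + |τ - t|) := by
  have hd := ((hφ j x hx rfl).differentiableWithinAt one_ne_zero).hasFDerivWithinAt
  set D := fderivWithin ℝ (fun q : ℝ × ℝ => φ (G.pt j q.1) q.2) (Icc 0 (G.len j) ×ˢ univ) (x, t)
  have h1 : D (1, 0) = edgeDeriv φ j x t := by
    have h := hd.comp_hasDerivWithinAt (f := fun y : ℝ => (y, t)) (f' := ((1 : ℝ), (0 : ℝ))) x
      ((hasDerivWithinAt_id x (Icc 0 (G.len j))).prodMk (hasDerivWithinAt_const x _ t))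
      fun y hy => ⟨hy, mem_univ _⟩
    exact (h.derivWithin ((uniqueDiffOn_Icc (G.len_pos j)) x hx)).symm
  have h2 : D (0, 1) = deriv (φ (G.pt j x)) t := by
    have h := hd.comp_hasDerivWithinAt (f := fun s : ℝ => (x, s)) (f' := ((0 : ℝ), (1 : ℝ)))
      (s := univ) t
      ((hasDerivWithinAt_const t _ x).prodMk (hasDerivWithinAt_id t _))
      fun y hy => ⟨hx, mem_univ _⟩
    exact (hasDerivWithinAt_univ.1 h).deriv.symm
  have hD : ∀ a b : ℝ, D (a, b) = edgeDeriv φ j x t * a + deriv (φ (G.pt j x)) t * b := by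
    intro a b
    have : ((a, b) : ℝ × ℝ) = a • ((1 : ℝ), (0 : ℝ)) + b • ((0 : ℝ), (1 : ℝ)) := by simp
    rw [this, map_add, map_smul, map_smul, h1, h2, smul_eq_mul, smul_eq_mul]
    ring
  have hev := hd.isLittleO.def hε
  obtain ⟨ρ, hρ, hball⟩ := Metric.eventually_nhds_iff.1 (eventually_nhdsWithin_iff.1 hev)
  refine ⟨ρ, hρ, fun y hy hyx τ hτ => ?_⟩
  have := hball (y := (y, τ)) (by
    rw [Prod.dist_eq, Real.dist_eq, Real.dist_eq]; exact max_lt hyx hτ) ⟨hy, mem_univ _⟩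
  rw [Prod.mk_sub_mk, hD, Real.norm_eq_abs] at this
  refine this.trans (mul_le_mul_of_nonneg_left ?_ hε.le)
  rw [Prod.norm_def, Real.norm_eq_abs, Real.norm_eq_abs]
  exact max_le_add_of_nonneg (abs_nonneg _) (abs_nonneg _)

namespace Lagrangian

variable [Finite V] [Finite E] [Nonempty E]

/-- Comparing with the curve that arrives at `P` along an edge with a constant admissible velocity
`w` gives the inequality for this velocity. -/
theorem deriv_add_mul_le_of_isLocalMax (L : G.Lagrangian) {f : G.Pt → ℝ} (hf : Continuous f)
    {φ : G.Pt → ℝ → ℝ} {j : E} {x t : ℝ} (ht : 0 < t) (hx : x ∈ Icc 0 (G.len j))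
    (hφ : C1Near φ (G.pt j x) t)
    (hmax : IsLocalMax (fun q : G.Pt × ℝ => L.value f q.1 q.2 - φ q.1 q.2) (G.pt j x, t))
    {w : ℝ} (h₀ : x = 0 → w ≤ 0) (h₁ : x = G.len j → 0 ≤ w) :
    deriv (φ (G.pt j x)) t + edgeDeriv φ j x t * w ≤ L.toFun j x w := by
  refine le_of_forall_pos_le_add fun ε hε => ?_
  obtain ⟨ρ₁, hρ₁, hexp⟩ := hφ.exists_pos_abs_sub_le hx
    (show 0 < ε / 2 / (|w| + 1) by positivity)
  obtain ⟨ρ₂, hρ₂, hloc⟩ := Metric.eventually_nhds_iff.1 hmax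
  obtain ⟨ρ₃, hρ₃, hcont⟩ := Metric.eventually_nhds_iff.1 (eventually_nhdsWithin_iff.1
    ((L.continuousWithinAt_toFun_left hx w).eventually
      (eventually_le_nhds (show L.toFun j x w < L.toFun j x w + ε / 2 by linarith))))
  set ρ := min ρ₁ (min ρ₂ ρ₃) with hρ
  have hρ0 : 0 < ρ := by positivity
  have hmem : ∀ᶠ s in 𝓝[>] (0 : ℝ), x - w * s ∈ Icc 0 (G.len j) := by
    have hc : Tendsto (fun s : ℝ => x - w * s) (𝓝[>] 0) (𝓝 x) := by
      refine Tendsto.mono_left ?_ nhdsWithin_le_nhds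
      have : ContinuousAt (fun s : ℝ => x - w * s) 0 := by fun_prop
      simpa [ContinuousAt] using this
    have hlo : ∀ᶠ s in 𝓝[>] (0 : ℝ), 0 ≤ x - w * s := by
      rcases hx.1.eq_or_lt with h | h
      · filter_upwards [self_mem_nhdsWithin] with s (hs : 0 < s)
        nlinarith [h₀ h.symm]
      · exact hc.eventually (eventually_ge_nhds h)
    have hhi : ∀ᶠ s in 𝓝[>] (0 : ℝ), x - w * s ≤ G.len j := by
      rcases hx.2.eq_or_lt with h | h
      · filter_upwards [self_mem_nhdsWithin] with s (hs : 0 < s)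
        nlinarith [h₁ h]
      · exact hc.eventually (eventually_le_nhds h)
    exact hlo.and hhi
  have hsmall : ∀ᶠ s in 𝓝[>] (0 : ℝ), s ∈ Ioo 0 (min t (ρ / (|w| + 1))) :=
    Ioo_mem_nhdsGT (by positivity)
  obtain ⟨s, hs, hs0, hslt⟩ := (hmem.and hsmall).exists
  rw [lt_min_iff, lt_div_iff₀ (by positivity)] at hslt
  obtain ⟨hst, hsρ⟩ := hslt
  have hw0 := abs_nonneg w
  have hsρ' : s < ρ := by nlinarith
  have hwρ : |w| * s < ρ := by nlinarith
  have hstart : x + w * (t - s - t) = x - w * s := by ring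
  have hle : t - s ≤ t := by linarith
  obtain ⟨hcurve, hint⟩ := L.isFiniteCurve_segment (w := w) hle hx (by rwa [hstart])
  have hdp := hcurve.value_le_value_add (by linarith) hle hf
  rw [hint] at hdp
  simp only [hstart, sub_self, mul_zero, add_zero] at hdp
  have habs : |x - w * s - x| = |w| * s := by
    rw [sub_sub_cancel_left, abs_neg, abs_mul, abs_of_pos hs0]
  have habs' : |t - s - t| = s := by rw [sub_sub_cancel_left, abs_neg, abs_of_pos hs0]
  have h1 := hexp (x - w * s) hs (by rw [habs]; exact hwρ.trans_le (min_le_left _ _)) (t - s)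
    (by rw [habs']; exact hsρ'.trans_le (min_le_left _ _))
  rw [habs, habs'] at h1
  have h2 := hloc (y := (G.pt j (x - w * s), t - s)) (by
    rw [Prod.dist_eq, Real.dist_eq, habs']
    have hρ₂' : ρ ≤ ρ₂ := (min_le_right _ _).trans (min_le_left _ _)
    refine max_lt ((dist_pt_le hs hx).trans_lt ?_) (hsρ'.trans_le hρ₂')
    rw [abs_sub_comm, habs]
    exact hwρ.trans_le hρ₂')
  simp only at h2
  have h3 : ∫ τ in (t - s)..t, L.toFun j (x + w * (τ - t)) w ≤ s * (L.toFun j x w + ε / 2) := by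
    calc _ ≤ ∫ τ in (t - s)..t, (L.toFun j x w + ε / 2) := by
          refine intervalIntegral.integral_mono_on hle ?_ (by simp) fun τ hτ => ?_
          · refine ContinuousOn.intervalIntegrable ?_
            rw [uIcc_of_le hle]
            exact L.continuousOn_toFun_segment hx (by rwa [hstart])
          · refine hcont (y := x + w * (τ - t)) ?_
              (add_mul_sub_mem_Icc hx (by rwa [hstart]) hτ)
            rw [Real.dist_eq, add_sub_cancel_left, abs_mul]
            have h4 : |τ - t| ≤ s := by
              rw [abs_le]; constructor <;> linarith [hτ.1, hτ.2]
            exact ((mul_le_mul_of_nonneg_left h4 hw0).trans_lt hwρ).trans_le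
              ((min_le_right _ _).trans (min_le_right _ _))
      _ = _ := by rw [intervalIntegral.integral_const, smul_eq_mul, sub_sub_cancel]
  have h5 : ε / 2 / (|w| + 1) * (|w| * s + s) = s * (ε / 2) := by field_simp
  rw [h5] at h1
  have h6 := (abs_le.1 h1).2
  have h7 : s * (deriv (φ (G.pt j x)) t + edgeDeriv φ j x t * w) ≤
      s * (L.toFun j x w + ε) := by
    linarith
  exact le_of_mul_le_mul_left h7 hs0

theorem isViscositySubsolution_value (L : G.Lagrangian) {f : G.Pt → ℝ} (hf : Continuous f) :
    L.IsViscositySubsolution (L.value f) := by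
  intro P t ht φ hφ hmax
  obtain ⟨j₀, x₀, hx₀, hP₀⟩ := exists_pt_eq P
  rw [← le_neg_iff_add_nonpos_left]
  refine csSup_le ⟨_, j₀, x₀, hx₀, hP₀, rfl⟩ ?_
  rintro _ ⟨j, x, hx, rfl, rfl⟩
  refine L.hamiltonian_le fun w h₀ h₁ => ?_
  have := L.deriv_add_mul_le_of_isLocalMax hf ht hx hφ hmax h₀ h₁
  linarith

end Lagrangian

end MetricGraph

/-! ### The supersolution property -/

namespace MetricGraph

variable {V E : Type*} {G : MetricGraph V E}

theorem exists_abs_glue_sub_glue_le [Finite E] {ψ : E → ℝ → ℝ} (hψ : ∀ j, ContDiff ℝ 1 (ψ j))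
    (h₀ : ∀ j, ψ j 0 = 0) (h₁ : ∀ j, ψ j (G.len j) = 0) :
    ∃ K, ∀ P Q, |glue G (fun _ => 0) ψ P - glue G (fun _ => 0) ψ Q| ≤ K * dist P Q := by
  have hlip : ∀ j, ∃ K, ∀ a ∈ Icc 0 (G.len j), ∀ b ∈ Icc 0 (G.len j),
      |ψ j b - ψ j a| ≤ K * |b - a| := by
    intro j
    obtain ⟨K, hK⟩ := (hψ j).contDiffOn.exists_lipschitzOnWith (by decide)
      (convex_Icc 0 (G.len j)) isCompact_Icc
    refine ⟨K, fun a ha b hb => ?_⟩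
    simpa [Real.dist_eq] using hK.dist_le_mul b hb a ha
  choose K hK using hlip
  obtain ⟨M, hM⟩ := (finite_range K).bddAbove
  refine ⟨max M 0, abs_glue_sub_glue_le (le_max_right _ _) h₀ h₁
    fun j a ha b hb => ?_⟩
  refine (hK j a ha b hb).trans (mul_le_mul_of_nonneg_right ?_ (abs_nonneg _))
  exact (hM ⟨j, rfl⟩).trans (le_max_left _ _)

namespace Lagrangian

/-- `g` is a Lipschitz function that vanishes at `P` and whose slopes are, on the ball of radius `r`
around `P`, subcritical for `L + c`. By `sub_le_integral_along_of_hasDerivAt` it bounds from below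
the action of the curves in this ball. -/
structure IsCalibration (L : G.Lagrangian) (P : G.Pt) (r c : ℝ) (g : G.Pt → ℝ) : Prop where
  lipschitz : ∃ K, ∀ Q Q', |g Q - g Q'| ≤ K * dist Q Q'
  apply_self : g P = 0
  vertex : ∀ v, dist (Pt.vertex v) P < r → 0 ≤ L.rest v + c
  inner : ∀ j x hx, dist (Pt.inner j x hx) P < r →
    ∃ p, HasDerivAt (fun y => g (G.pt j y)) p x ∧ ∀ w, p * w ≤ L.toFun j x w + c

section Core

variable [Finite V] [Finite E] [Nonempty E]

/-- Near `P`, the value function cannot lie above functions `A * (t - τ) + g` with calibrations `g`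
for a constant `c < A`: a nearly optimal curve that ends at `P` at time `t` stays near `P` for
a short time, by superlinearity, and along it the value function would have to grow faster than its
action allows. -/
theorem not_forall_exists_isCalibration (L : G.Lagrangian) {f : G.Pt → ℝ} (hf : Continuous f)
    {P : G.Pt} {t A c r : ℝ} (ht : 0 < t) (hr : 0 < r) (hA : c < A) :
    ¬ ∀ Q, dist Q P < r → ∀ τ, τ ≤ t → t - τ < r → ∃ g, L.IsCalibration P r c g ∧
      L.value f P t + A * (t - τ) + g Q ≤ L.value f Q τ := by
  intro H
  obtain ⟨m, D, hmD⟩ := L.exists_forall_le_value hf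
  set K₀ := L.value f P t - (m - |D| * t) + 1 with hK₀
  have hlow : ∀ Q τ, 0 ≤ τ → τ ≤ t → m - |D| * t ≤ L.value f Q τ := fun Q τ h0 h1 => by
    have := hmD Q τ h0
    nlinarith [le_abs_self D, abs_nonneg D]
  have hK₀1 : 1 ≤ K₀ := by linarith [hlow P t ht.le le_rfl]
  set M := 2 * K₀ / r with hM
  have hM0 : 0 < M := by positivity
  have hMr : M * r = 2 * K₀ := by rw [hM]; field_simp
  obtain ⟨C, hC⟩ := L.exists_forall_mul_abs_sub_le M
  have hθ : 0 < (A - c) / 2 := by linarith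
  -- The time is short enough for the bound `K₀ + C * s < M * r` on `M` times the displacement.
  obtain ⟨s, hs0, hs⟩ : ∃ s, 0 < s ∧ s < min t (min r (K₀ / (|C| + 1))) :=
    exists_between (by positivity)
  rw [lt_min_iff, lt_min_iff, lt_div_iff₀ (by positivity)] at hs
  obtain ⟨hst, hsr, hsC⟩ := hs
  obtain ⟨γ, hγ, hγt, hopt⟩ := exists_curve_lt_of_value_lt (L := L) (f := f) (x := P) ht.le
    (lt_add_of_pos_right (L.value f P t) (show 0 < min 1 ((A - c) / 2 * s) by positivity))
  have hsplit : ∀ τ ∈ Icc 0 t, L.IsFiniteCurve γ τ t ∧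
      L.value f (γ τ) τ + ∫ σ in τ..t, L.along γ σ <
        L.value f P t + min 1 ((A - c) / 2 * s) := by
    intro τ hτ
    have hmem : τ ∈ uIcc 0 t := by rwa [uIcc_of_le ht.le]
    have h1 := hγ.mono (uIcc_subset_uIcc_left hmem)
    have h2 := hγ.mono (uIcc_subset_uIcc_right hmem)
    have h3 := h1.value_le hτ.1 hf
    have h4 := intervalIntegral.integral_add_adjacent_intervals h1.integrable h2.integrable
    exact ⟨h2, by linarith⟩
  have hstay : ∀ τ ∈ Icc (t - s) t, dist (γ τ) P < r := by
    intro τ hτ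
    have hτ0 : τ ∈ Icc 0 t := ⟨by linarith [hτ.1], hτ.2⟩
    obtain ⟨h1, h2⟩ := hsplit τ hτ0
    have h3 := h1.mul_dist_le hτ.2 hM0.le hC
    rw [hγt] at h3
    have h4 := hlow (γ τ) τ hτ0.1 hτ0.2
    have h5 : C * (t - τ) ≤ |C| * s := by
      have h6 : t - τ ≤ s := by linarith [hτ.1]
      have h7 : 0 ≤ t - τ := by linarith [hτ.2]
      nlinarith [le_abs_self C, abs_nonneg C]
    have h8 := min_le_left 1 ((A - c) / 2 * s)
    refine lt_of_mul_lt_mul_left ?_ hM0.le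
    rw [hMr]
    nlinarith [abs_nonneg C]
  have hmem : t - s ∈ Icc (t - s) t := ⟨le_rfl, by linarith⟩
  obtain ⟨h1, h2⟩ := hsplit (t - s) ⟨by linarith, by linarith⟩
  obtain ⟨g, hg, hle⟩ := H (γ (t - s)) (hstay _ hmem) (t - s) hmem.2 (by linarith)
  obtain ⟨K, hK⟩ := hg.lipschitz
  have h3 := sub_le_integral_along_of_hasDerivAt (L := L) (c := c) hmem.2 h1.absCont h1.integrable
    hK (fun τ hτ v hv => hg.vertex v (by rw [← hv]; exact hstay τ (Ioo_subset_Icc_self hτ)))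
    fun τ hτ j x hx hP => hg.inner j x hx (by rw [← hP]; exact hstay τ (Ioo_subset_Icc_self hτ))
  rw [hγt, hg.apply_self] at h3
  rw [sub_sub_cancel] at h3 hle
  have h4 := min_le_right 1 ((A - c) / 2 * s)
  have h5 : 0 < (A - c) * s := mul_pos (by linarith) hs0
  linarith

end Core

/-- The analysis at one end `x` of an edge, or on one side of an interior point `x`. The slope `q`
is at most the slope of the test function in the direction of the points of `S`, and subcritical for
all velocities. Shifting it by a small amount leaves room for both the first order error of
the test function and a nearby position. -/
theorem exists_slope (L : G.Lagrangian) {u φ : G.Pt → ℝ → ℝ} {j : E} {x t κ : ℝ} (hκ : 0 < κ)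
    (hx : x ∈ Icc 0 (G.len j)) (hφ : C1Near φ (G.pt j x) t)
    (hmin : IsLocalMin (fun z : G.Pt × ℝ => u z.1 z.2 - φ z.1 z.2) (G.pt j x, t))
    {S : Set ℝ} (hS : S ⊆ Icc 0 (G.len j)) {s : ℝ} (hs : |s| = 1)
    (hSs : ∀ y ∈ S, |y - x| = s * (y - x)) {q : ℝ}
    (hq : ∀ y ∈ S, q * (y - x) ≤ edgeDeriv φ j x t * (y - x))
    (hqL : ∀ w, q * w ≤ L.toFun j x w + (-deriv (φ (G.pt j x)) t - κ)) :
    ∃ σ, ∀ ψ : ℝ → ℝ, ContDiff ℝ 1 ψ → ψ x = 0 → HasDerivAt ψ σ x → ∃ ρ > 0,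
      (∀ y ∈ S, |y - x| < ρ → ∀ τ, τ ≤ t → t - τ < ρ →
        u (G.pt j x) t + (-deriv (φ (G.pt j x)) t - κ / 4) * (t - τ) + ψ y ≤ u (G.pt j y) τ) ∧
      ∀ y ∈ Icc 0 (G.len j), |y - x| < ρ → ∀ w,
        deriv ψ y * w ≤ L.toFun j y w + (-deriv (φ (G.pt j x)) t - κ / 2) := by
  set a := deriv (φ (G.pt j x)) t
  set p := edgeDeriv φ j x t
  obtain ⟨η, hη, hpert⟩ := L.exists_pos_forall_mul_le_of_lt hx hqL
    (show -a - κ < -a - κ / 2 by linarith)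
  refine ⟨q - s * (η / 2), fun ψ hψ hψx hψσ => ?_⟩
  obtain ⟨ρ₁, hρ₁, hexp⟩ := hφ.exists_pos_abs_sub_le hx
    (show 0 < min (κ / 4) (η / 4) by positivity)
  obtain ⟨ρ₂, hρ₂, hloc⟩ := Metric.eventually_nhds_iff.1 hmin
  obtain ⟨ρ₃, hρ₃, hψ3⟩ := Metric.eventually_nhds_iff.1
    (hψσ.isLittleO.def (show 0 < η / 4 by positivity))
  have hcont : ContinuousAt (deriv ψ) x := (hψ.continuous_deriv le_rfl).continuousAt
  obtain ⟨ρ₄, hρ₄, hψ4⟩ := Metric.continuousAt_iff.1 hcont (η / 2) (by positivity)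
  refine ⟨min ρ₁ (min ρ₂ (min ρ₃ (min ρ₄ η))), by positivity, ?_, ?_⟩
  · intro y hy hyx τ hτ hτρ
    simp only [lt_min_iff] at hyx hτρ
    have habs : |τ - t| = t - τ := by rw [abs_sub_comm, abs_of_nonneg (by linarith)]
    have h1 := (abs_le.1 (hexp y (hS hy) hyx.1 τ (by rw [habs]; exact hτρ.1))).1
    have h2 := hloc (y := (G.pt j y, τ)) (by
      rw [Prod.dist_eq, Real.dist_eq, habs]
      refine max_lt ((dist_pt_le (hS hy) hx).trans_lt ?_) hτρ.2.1
      rw [abs_sub_comm]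
      exact hyx.2.1)
    simp only at h2
    have h3 := hψ3 (y := y) (by rw [Real.dist_eq]; exact hyx.2.2.1)
    rw [hψx, sub_zero, Real.norm_eq_abs, Real.norm_eq_abs, smul_eq_mul] at h3
    have h3' := (abs_le.1 h3).2
    have h4 := hq y hy
    have h5 : (y - x) * (q - s * (η / 2)) = q * (y - x) - η / 2 * |y - x| := by
      rw [hSs y hy]; ring
    have h6 : min (κ / 4) (η / 4) * (|y - x| + |τ - t|) ≤ η / 4 * |y - x| + κ / 4 * (t - τ) := by
      rw [mul_add, habs]
      exact add_le_add (mul_le_mul_of_nonneg_right (min_le_right _ _) (abs_nonneg _))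
        (mul_le_mul_of_nonneg_right (min_le_left _ _) (by linarith))
    linarith
  · intro y hy hyx w
    simp only [lt_min_iff] at hyx
    refine hpert y hy hyx.2.2.2.2 _ ?_ w
    have h1 := hψ4 (x := y) (by rw [Real.dist_eq]; exact hyx.2.2.2.1)
    rw [hψσ.deriv, Real.dist_eq] at h1
    have h2 : |s * (η / 2)| = η / 2 := by rw [abs_mul, hs, one_mul, abs_of_pos (by positivity)]
    have h3 := abs_sub_le (deriv ψ y) (q - s * (η / 2)) q
    rw [sub_sub_cancel_left, abs_neg, h2] at h3
    linarith

theorem isCalibration_glue [Finite E] (L : G.Lagrangian) {P : G.Pt} {r c : ℝ} {ψ : E → ℝ → ℝ}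
    (hψ : ∀ j, ContDiff ℝ 1 (ψ j)) (h₀ : ∀ j, ψ j 0 = 0) (h₁ : ∀ j, ψ j (G.len j) = 0)
    (hP : glue G (fun _ => 0) ψ P = 0)
    (hv : ∀ v, dist (Pt.vertex v) P < r → 0 ≤ L.rest v + c)
    (hi : ∀ j x hx, dist (Pt.inner j x hx) P < r → ∀ w, deriv (ψ j) x * w ≤ L.toFun j x w + c) :
    L.IsCalibration P r c (glue G (fun _ => 0) ψ) := by
  refine ⟨exists_abs_glue_sub_glue_le hψ h₀ h₁, hP, hv, fun j x hx hd => ⟨_, ?_, hi j x hx hd⟩⟩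
  have h := ((hψ j).differentiable one_ne_zero x).hasDerivAt
  refine h.congr_of_eventuallyEq ?_
  filter_upwards [isOpen_Ioo.mem_nhds hx] with y hy
  exact glue_pt (h₀ j) (h₁ j) (Ioo_subset_Icc_self hy)

/-- The cubic polynomial that vanishes at `0` and `l` and has the derivatives `σ` and `σ'` there. -/
noncomputable def hermite (l σ σ' y : ℝ) : ℝ :=
  σ / l ^ 2 * (y * (l - y) ^ 2) + σ' / l ^ 2 * (y ^ 2 * (y - l))

theorem contDiff_hermite (l σ σ' : ℝ) : ContDiff ℝ 1 (hermite l σ σ') := by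
  unfold hermite; fun_prop

theorem hasDerivAt_hermite (l σ σ' y : ℝ) :
    HasDerivAt (hermite l σ σ') (σ / l ^ 2 * ((l - y) ^ 2 - 2 * y * (l - y)) +
      σ' / l ^ 2 * (2 * y * (y - l) + y ^ 2)) y := by
  have h1 := (hasDerivAt_id y).mul (((hasDerivAt_id y).const_sub l).pow 2)
  have h2 := ((hasDerivAt_id y).pow 2).mul ((hasDerivAt_id y).sub_const l)
  refine ((h1.const_mul (σ / l ^ 2)).add (h2.const_mul (σ' / l ^ 2))).congr_deriv ?_
  simp only [Pi.pow_apply, id_eq, Nat.cast_ofNat, Nat.add_one_sub_one, pow_one]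
  ring

/-- At an end of an edge, the slope of the test function may be replaced by its minimum (at the
parameter `0`; its maximum at the other end) with a subgradient of `L` at the velocity `0`. This
lowers the test function, and makes the inequality for the incoming velocities one for all
velocities, because the outgoing ones are no better than the velocity `0`. -/
theorem exists_slope_of_end [Finite E] (L : G.Lagrangian) {u φ : G.Pt → ℝ → ℝ} {j : E} {x t κ : ℝ}
    (hx : x = 0 ∨ x = G.len j) (hκ0 : 0 < κ) (hφ : C1Near φ (G.pt j x) t)
    (hκ : κ = -(deriv (φ (G.pt j x)) t + L.hamiltonianAt φ (G.pt j x) t))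
    (hmin : IsLocalMin (fun z : G.Pt × ℝ => u z.1 z.2 - φ z.1 z.2) (G.pt j x, t)) :
    ∃ σ, ∀ ψ : ℝ → ℝ, ContDiff ℝ 1 ψ → ψ x = 0 → HasDerivAt ψ σ x → ∃ ρ > 0,
      (∀ y ∈ Icc 0 (G.len j), |y - x| < ρ → ∀ τ, τ ≤ t → t - τ < ρ →
        u (G.pt j x) t + (-deriv (φ (G.pt j x)) t - κ / 4) * (t - τ) + ψ y ≤ u (G.pt j y) τ) ∧
      ∀ y ∈ Icc 0 (G.len j), |y - x| < ρ → ∀ w,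
        deriv ψ y * w ≤ L.toFun j y w + (-deriv (φ (G.pt j x)) t - κ / 2) := by
  have hl := G.len_pos j
  have hx' : x ∈ Icc 0 (G.len j) := by
    rcases hx with rfl | rfl
    · exact ⟨le_rfl, hl.le⟩
    · exact ⟨hl.le, le_rfl⟩
  have hH := L.hamiltonian_le_hamiltonianAt φ hx' t
  set p := edgeDeriv φ j x t with hp
  obtain ⟨q, hq⟩ := (L.strictConvexOn j x hx').convexOn.exists_forall_add_mul_le
  have hw := fun w h₀ h₁ => L.mul_sub_le_hamiltonian hx' p (w := w) h₀ h₁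
  have h0 := hw 0 (fun _ => le_rfl) (fun _ => le_rfl)
  rcases hx with rfl | rfl
  · refine L.exists_slope hκ0 hx' hφ hmin (S := Icc 0 (G.len j)) subset_rfl (s := 1) (by simp)
      (q := min p q) (fun y hy => by rw [sub_zero, one_mul, abs_of_nonneg hy.1])
      (fun y hy => mul_le_mul_of_nonneg_right (min_le_left _ _) (by simpa using hy.1)) fun w => ?_
    have h1 := hq w
    rcases le_total p q with hpq | hpq
    · rw [min_eq_left hpq]
      rcases le_total w 0 with hw0 | hw0
      · have := hw w (fun _ => hw0) (fun h => absurd h hl.ne)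
        linarith
      · have := mul_le_mul_of_nonneg_right hpq hw0
        linarith
    · rw [min_eq_right hpq]
      linarith
  · refine L.exists_slope hκ0 hx' hφ hmin (S := Icc 0 (G.len j)) subset_rfl (s := -1) (by simp)
      (q := max p q) (fun y hy => by rw [abs_of_nonpos (sub_nonpos.2 hy.2)]; ring)
      (fun y hy => mul_le_mul_of_nonpos_right (le_max_left _ _) (sub_nonpos.2 hy.2)) fun w => ?_
    have h1 := hq w
    rcases le_total p q with hpq | hpq
    · rw [max_eq_right hpq]
      linarith
    · rw [max_eq_left hpq]
      rcases le_total w 0 with hw0 | hw0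
      · have := mul_le_mul_of_nonpos_right hpq hw0
        linarith
      · have := hw w (fun h => absurd h hl.ne') (fun _ => hw0)
        linarith

variable [Finite V] [Finite E] [Nonempty E]

/-- The supersolution inequality inside an edge. The two sides of the point use different
calibrations: a first order error is absorbed by lowering the slope on the right and by raising it
on the left, and a curve that starts on one side may cross the point. -/
theorem deriv_add_hamiltonianAt_nonneg_inner (L : G.Lagrangian) {f : G.Pt → ℝ} (hf : Continuous f)
    {φ : G.Pt → ℝ → ℝ} {j : E} {x t : ℝ} (hx : x ∈ Ioo 0 (G.len j)) (ht : 0 < t)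
    (hφ : C1Near φ (Pt.inner j x hx) t)
    (hmin : IsLocalMin (fun z : G.Pt × ℝ => L.value f z.1 z.2 - φ z.1 z.2) (Pt.inner j x hx, t)) :
    0 ≤ deriv (φ (Pt.inner j x hx)) t + L.hamiltonianAt φ (Pt.inner j x hx) t := by
  classical
  by_contra! hneg
  have hx' := Ioo_subset_Icc_self hx
  have hP := G.pt_inner j x hx
  have hH := L.hamiltonian_le_hamiltonianAt φ hx' t
  rw [hP] at hH
  rw [← hP] at hφ hmin hneg
  obtain ⟨κ, hκ⟩ : ∃ κ, κ = -(deriv (φ (G.pt j x)) t + L.hamiltonianAt φ (G.pt j x) t) := ⟨_, rfl⟩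
  have hκ0 : 0 < κ := by linarith
  rw [← hP] at hH
  have hqL : ∀ w, edgeDeriv φ j x t * w ≤ L.toFun j x w + (-deriv (φ (G.pt j x)) t - κ) := by
    intro w
    have := L.mul_sub_le_hamiltonian hx' (edgeDeriv φ j x t) (w := w)
      (fun h => absurd h hx.1.ne') (fun h => absurd h hx.2.ne)
    linarith
  have hprod : x * (G.len j - x) ≠ 0 := (mul_pos hx.1 (sub_pos.2 hx.2)).ne'
  -- Polynomials that vanish at both ends and at `x`, with the derivative `σ` at `x`.
  let ψ : ℝ → E → ℝ → ℝ := fun σ k y =>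
    if k = j then σ / (x * (G.len j - x)) * (y * (G.len j - y) * (y - x)) else 0
  have hψC : ∀ σ k, ContDiff ℝ 1 (ψ σ k) := by
    intro σ k
    by_cases hk : k = j
    · simp only [ψ, hk, if_true]; fun_prop
    · simp only [ψ, hk, if_false]; fun_prop
  have hψx : ∀ σ, ψ σ j x = 0 := by simp [ψ]
  have hψd : ∀ σ, HasDerivAt (ψ σ j) σ x := by
    intro σ
    simp only [ψ, if_true]
    refine ((((hasDerivAt_id x).mul ((hasDerivAt_id x).const_sub (G.len j))).mul
      ((hasDerivAt_id x).sub_const x)).const_mul _).congr_deriv ?_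
    simp
    field_simp
    rw [mul_assoc, mul_div_assoc, div_self hprod, mul_one]
  have hψ0 : ∀ σ k, ψ σ k 0 = 0 := by
    intro σ k
    by_cases hk : k = j <;> simp [ψ, hk]
  have hψ1 : ∀ σ k, ψ σ k (G.len k) = 0 := by
    intro σ k
    by_cases hk : k = j
    · subst hk; simp [ψ]
    · simp [ψ, hk]
  obtain ⟨σ₁, h₁⟩ := L.exists_slope hκ0 hx' hφ hmin (S := Icc 0 (G.len j) ∩ Ici x)
    inter_subset_left (s := 1) (by simp)
    (fun y hy => by rw [abs_of_nonneg (sub_nonneg.2 hy.2), one_mul]) (fun y _ => le_rfl) hqL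
  obtain ⟨σ₂, h₂⟩ := L.exists_slope hκ0 hx' hφ hmin (S := Icc 0 (G.len j) ∩ Iic x)
    inter_subset_left (s := -1) (by simp)
    (fun y hy => by rw [abs_of_nonpos (sub_nonpos.2 hy.2)]; ring) (fun y _ => le_rfl) hqL
  obtain ⟨ρ₁, hρ₁, h₁u, h₁L⟩ := h₁ (ψ σ₁ j) (hψC σ₁ j) (hψx σ₁) (hψd σ₁)
  obtain ⟨ρ₂, hρ₂, h₂u, h₂L⟩ := h₂ (ψ σ₂ j) (hψC σ₂ j) (hψx σ₂) (hψd σ₂)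
  have hr : 0 < min (min ρ₁ ρ₂) (min x (G.len j - x)) :=
    lt_min (lt_min hρ₁ hρ₂) (lt_min hx.1 (sub_pos.2 hx.2))
  have hcal : ∀ σ, (∀ y ∈ Icc 0 (G.len j), |y - x| < min ρ₁ ρ₂ → ∀ w, deriv (ψ σ j) y * w ≤
      L.toFun j y w + (-deriv (φ (G.pt j x)) t - κ / 2)) →
      L.IsCalibration (G.pt j x) (min (min ρ₁ ρ₂) (min x (G.len j - x)))
        (-deriv (φ (G.pt j x)) t - κ / 2) (glue G (fun _ => 0) (ψ σ)) := by
    intro σ hσ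
    refine L.isCalibration_glue (hψC σ) (hψ0 σ) (hψ1 σ) ?_ (fun v hv => ?_) fun k y hy hd => ?_
    · rw [glue_pt (hψ0 σ j) (hψ1 σ j) hx', hψx]
    · rw [hP] at hv
      obtain ⟨y, hy, h, -⟩ := exists_inner_of_dist_lt hx (hv.trans_le (min_le_right _ _))
      exact absurd h (by simp)
    · rw [hP] at hd
      obtain ⟨y', hy', h, hle⟩ := exists_inner_of_dist_lt hx (hd.trans_le (min_le_right _ _))
      injection h with hk hyy
      subst hk hyy
      exact hσ y (Ioo_subset_Icc_self hy) (hle.trans_lt (hd.trans_le (min_le_left _ _)))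
  refine L.not_forall_exists_isCalibration hf ht hr
    (show -deriv (φ (G.pt j x)) t - κ / 2 < -deriv (φ (G.pt j x)) t - κ / 4 by linarith)
    (P := G.pt j x) fun Q hQ τ hτ hτr => ?_
  rw [hP] at hQ
  obtain ⟨y, hy, rfl, hle⟩ := exists_inner_of_dist_lt hx (hQ.trans_le (min_le_right _ _))
  have hy' := Ioo_subset_Icc_self hy
  have hyx := hle.trans_lt (hQ.trans_le (min_le_left _ _))
  have hτ' := hτr.trans_le (min_le_left _ _)
  rw [← pt_inner]
  rcases le_total x y with hxy | hxy
  · refine ⟨_, hcal σ₁ fun z hz hzx => h₁L z hz (hzx.trans_le (min_le_left _ _)), ?_⟩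
    rw [glue_pt (hψ0 σ₁ j) (hψ1 σ₁ j) hy']
    exact h₁u y ⟨hy', hxy⟩ (hyx.trans_le (min_le_left _ _)) τ hτ (hτ'.trans_le (min_le_left _ _))
  · refine ⟨_, hcal σ₂ fun z hz hzx => h₂L z hz (hzx.trans_le (min_le_right _ _)), ?_⟩
    rw [glue_pt (hψ0 σ₂ j) (hψ1 σ₂ j) hy']
    exact h₂u y ⟨hy', hxy⟩ (hyx.trans_le (min_le_right _ _)) τ hτ
      (hτ'.trans_le (min_le_right _ _))

/-- The supersolution inequality at a vertex. One calibration serves all edges at the vertex; it is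
a cubic polynomial on each edge, with the slopes of `exists_slope_of_end` at the vertex. -/
theorem deriv_add_hamiltonianAt_nonneg_vertex (L : G.Lagrangian) {f : G.Pt → ℝ} (hf : Continuous f)
    {φ : G.Pt → ℝ → ℝ} {v : V} {t : ℝ} (ht : 0 < t) (hφ : C1Near φ (Pt.vertex v) t)
    (hmin : IsLocalMin (fun z : G.Pt × ℝ => L.value f z.1 z.2 - φ z.1 z.2) (Pt.vertex v, t)) :
    0 ≤ deriv (φ (Pt.vertex v)) t + L.hamiltonianAt φ (Pt.vertex v) t := by
  by_contra! hneg
  obtain ⟨κ, hκ⟩ : ∃ κ, κ = -(deriv (φ (Pt.vertex v)) t + L.hamiltonianAt φ (Pt.vertex v) t) :=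
    ⟨_, rfl⟩
  have hκ0 : 0 < κ := by linarith
  -- The behaviour near the vertex of a function `ψ` on an edge `j` that ends there at `x`.
  let Good : E → ℝ → (ℝ → ℝ) → ℝ → Prop := fun j x ψ ρ =>
    (∀ y ∈ Icc 0 (G.len j), |y - x| < ρ → ∀ τ, τ ≤ t → t - τ < ρ →
      L.value f (Pt.vertex v) t + (-deriv (φ (Pt.vertex v)) t - κ / 4) * (t - τ) + ψ y ≤
        L.value f (G.pt j y) τ) ∧
    ∀ y ∈ Icc 0 (G.len j), |y - x| < ρ → ∀ w,
      deriv ψ y * w ≤ L.toFun j y w + (-deriv (φ (Pt.vertex v)) t - κ / 2)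
  have hend : ∀ j x, x = 0 ∨ x = G.len j → ∃ σ, G.pt j x = Pt.vertex v →
      ∀ ψ : ℝ → ℝ, ContDiff ℝ 1 ψ → ψ x = 0 → HasDerivAt ψ σ x → ∃ ρ > 0, Good j x ψ ρ := by
    intro j x hx
    by_cases hP : G.pt j x = Pt.vertex v
    · rw [← hP] at hφ hmin hκ
      obtain ⟨σ, hσ⟩ := L.exists_slope_of_end hx hκ0 hφ hκ hmin
      rw [hP] at hσ
      exact ⟨σ, fun _ => hσ⟩
    · exact ⟨0, fun h => absurd h hP⟩
  choose σ hσ using fun j => hend j 0 (Or.inl rfl)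
  choose σ' hσ' using fun j => hend j (G.len j) (Or.inr rfl)
  let ψ : E → ℝ → ℝ := fun j => hermite (G.len j) (σ j) (σ' j)
  have hψC : ∀ j, ContDiff ℝ 1 (ψ j) := fun j => contDiff_hermite _ _ _
  have hψ0 : ∀ j, ψ j 0 = 0 := fun j => by simp [ψ, hermite]
  have hψ1 : ∀ j, ψ j (G.len j) = 0 := fun j => by simp [ψ, hermite]
  have hl := G.len_pos
  have hgood : ∀ j, ∃ ρ > 0, ∀ x, x = 0 ∨ x = G.len j → G.pt j x = Pt.vertex v →
      Good j x (ψ j) ρ := by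
    intro j
    have hmono : ∀ x ρ ρ', ρ' ≤ ρ → Good j x (ψ j) ρ → Good j x (ψ j) ρ' :=
      fun x ρ ρ' hle h => ⟨fun y hy hyx τ hτ hτρ =>
        h.1 y hy (hyx.trans_le hle) τ hτ (hτρ.trans_le hle),
        fun y hy hyx => h.2 y hy (hyx.trans_le hle)⟩
    have h₀ : ∃ ρ > 0, G.pt j 0 = Pt.vertex v → Good j 0 (ψ j) ρ := by
      by_cases hP : G.pt j 0 = Pt.vertex v
      · obtain ⟨ρ, hρ, h⟩ := hσ j hP (ψ j) (hψC j) (hψ0 j)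
          ((hasDerivAt_hermite _ _ _ _).congr_deriv (by have := (hl j).ne'; field_simp; ring))
        exact ⟨ρ, hρ, fun _ => h⟩
      · exact ⟨1, one_pos, fun h => absurd h hP⟩
    have h₁ : ∃ ρ > 0, G.pt j (G.len j) = Pt.vertex v → Good j (G.len j) (ψ j) ρ := by
      by_cases hP : G.pt j (G.len j) = Pt.vertex v
      · obtain ⟨ρ, hρ, h⟩ := hσ' j hP (ψ j) (hψC j) (hψ1 j)
          ((hasDerivAt_hermite _ _ _ _).congr_deriv (by have := (hl j).ne'; field_simp; ring))
        exact ⟨ρ, hρ, fun _ => h⟩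
      · exact ⟨1, one_pos, fun h => absurd h hP⟩
    obtain ⟨ρ, hρ, h₀⟩ := h₀
    obtain ⟨ρ', hρ', h₁⟩ := h₁
    refine ⟨min ρ ρ', lt_min hρ hρ', ?_⟩
    rintro x (rfl | rfl) hP
    · exact hmono _ _ _ (min_le_left _ _) (h₀ hP)
    · exact hmono _ _ _ (min_le_right _ _) (h₁ hP)
  choose ρ hρ0 hρ using hgood
  obtain ⟨j₀, hj₀⟩ := Finite.exists_min ρ
  obtain ⟨r, hr, hnear⟩ := exists_pt_eq_pt_eq_of_dist_lt (G := G) (Pt.vertex v)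
  -- The points near the vertex, with the properties of `ψ` at them.
  have hball : ∀ Q : G.Pt, dist Q (Pt.vertex v) < min r (ρ j₀) → ∃ j x, ∃ y ∈ Icc 0 (G.len j),
      Good j x (ψ j) (ρ j) ∧ G.pt j y = Q ∧ |y - x| < ρ j := by
    intro Q hQ
    obtain ⟨j, x, hx, y, hy, hP, hQy, hle⟩ := hnear Q (hQ.trans_le (min_le_left _ _))
    have hx' : x = 0 ∨ x = G.len j := (pt_eq_vertex hx hP).imp And.left And.left
    exact ⟨j, x, y, hy, hρ j x hx' hP, hQy,
      hle.trans_lt ((hQ.trans_le (min_le_right _ _)).trans_le (hj₀ j))⟩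
  refine L.not_forall_exists_isCalibration hf ht (lt_min hr (hρ0 j₀))
    (show -deriv (φ (Pt.vertex v)) t - κ / 2 < -deriv (φ (Pt.vertex v)) t - κ / 4 by linarith)
    (P := Pt.vertex v) fun Q hQ τ hτ hτr => ⟨glue G (fun _ => 0) ψ, ?_, ?_⟩
  · refine L.isCalibration_glue hψC hψ0 hψ1 rfl (fun w hw => ?_) fun j y hy hd w => ?_
    · obtain ⟨j, x, y, hy, hg, hQy, hyx⟩ := hball _ hw
      have h1 := hg.2 y hy hyx 0
      rw [mul_zero] at h1
      rcases pt_eq_vertex hy hQy with ⟨rfl, rfl⟩ | ⟨rfl, rfl⟩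
      · rwa [L.rest_src] at h1
      · rwa [L.rest_tgt] at h1
    · obtain ⟨k, x, z, hz, hg, hQz, hzx⟩ := hball _ hd
      obtain ⟨rfl, rfl⟩ := pt_eq_inner hQz
      exact hg.2 z hz hzx w
  · obtain ⟨j, x, y, hy, hg, rfl, hyx⟩ := hball Q hQ
    rw [glue_pt (hψ0 j) (hψ1 j) hy]
    exact hg.1 y hy hyx τ hτ ((hτr.trans_le (min_le_right _ _)).trans_le (hj₀ j))

theorem isViscositySupersolution_value (L : G.Lagrangian) {f : G.Pt → ℝ} (hf : Continuous f) :
    L.IsViscositySupersolution (L.value f) := by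
  rintro (v | ⟨j, x, hx⟩) t ht φ hφ hmin
  · exact L.deriv_add_hamiltonianAt_nonneg_vertex hf ht hφ hmin
  · exact L.deriv_add_hamiltonianAt_nonneg_inner hf hx ht hφ hmin

end Lagrangian

end MetricGraph

theorem mainTheorem8 {V E : Type*} [Finite V] [Finite E] [Nonempty E] (G : MetricGraph V E)
    (L : G.Lagrangian) (f : G.Pt → ℝ) (hf : Continuous f) :
    ∃ u : G.Pt → ℝ → ℝ, (∀ (x : G.Pt) (t : ℝ), 0 ≤ t → (u x t : EReal) = L.laxOleinik t f x) ∧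
      L.IsViscositySolution u :=
  ⟨L.value f, fun x _ ht => L.coe_value_eq_laxOleinik hf x ht, L.continuousOn_value hf,
    L.isViscositySubsolution_value hf, L.isViscositySupersolution_value hf⟩
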